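/- **Nets.** A multi reversing Petri net (MRPN) $(P,T,A,A_V,B,F)$ consists of finite sets $P$ (places), $T$ (transitions), $A$ (token types), $A_V$ (token variables, each $v$ with a type $\mathrm{type}(v)\in A$), a set $B$ of undirected bond types on $A$, and arc labels $F(x,t),F(t,x)$ ($x\in P$, $t\in T$), which are sets of variables and undirected bonds of variables; if a bond $(u,v)$ lies in a label then so do $u$ and $v$, and the pair of their types is in $B$. Let $\mathrm{pre}(t)=\bigcup_xF(x,t)$ and $\mathrm{post}(t)=\bigcup_xF(t,x)$. The net is well-formed if for every $t$: $A_V\cap\mathrm{pre}(t)=A_V\cap\mathrm{post}(t)$, and no variable lies in both $F(t,x)$ and $F(t,y)$ for $x\ne y$. **States.** Token instances are $(a,*,i)$ ($a\in A$, $i\in\mathbb N$) and, recursively, $(a_i,k,u)$ with $a_i$ a token instance, $k\in\mathbb N$ (a key) and $u\in A_V\cup\{*\}$. The origin of an instance is the $(a,*,i)$ from which it is built, its type is $a$, and $a_i\,\overline\in\,a_j$ means that $a_j$ arises from $a_i$ by adding zero or more memories. A state $\langle M,H\rangle$ consists of a marking $M$ (a set $M(x)$ of token instances and bonds of token instances for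 each place $x$) and a history $H:T\to2^{\mathbb N}$; $(t,k)$ is an occurrence in it if $k\in H(t)$. A state is initial if all its tokens have the form $(a,*,i)$, each lies in at most one place, each bond has its type in $B$ and lies in a place together with both its ends, and $H(t)=\emptyset$ for all $t$. $\mathrm{con}(a,C)$ denotes the tokens of $C$ connected to $a$ via bonds of $C$, together with these bonds. For a map $U$ from variables to instances let $U(\mathrm{pre}(t))$, $U(\mathrm{post}(t))$ be the images of $\mathrm{pre}(t)$, $\mathrm{post}(t)$. **Forward steps.** $\langle M,H\rangle\xrightarrow{(t,k)}\langle M',H'\rangle$ if $k=\max(\{0\}\cup\bigcup_{t'}H(t'))+1$ and there is an injective $U:A_V\cap\mathrm{pre}(t)\to$ instances such that: for $u\in F(x,t)$, $U(u)\in M(x)$ has the type of $u$; for $(u,v)\in F(x,t)$, $(U(u),U(v))\in M(x)$; if $u,v\in F(x,t)$ and $(U(u),U(v))\in M(x)$ then $(u,v)\in F(x,t)$; if $u\in F(t,y_1)$, $v\in F(t,y_2)$ with $y_1\neq y_2$, then $U(u)\notin\mathrm{con}(U(v),(M(x)-U(\mathrm{pre}(t)))\cup U(\mathrm{post}(t)))$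 for all $x$ with $F(x,t)\neq\emptyset$. Then $H'$ is $H$ with $k$ added to $H(t)$, and $M'(x)$ is obtained from $M(x)$ by removing $\mathrm{con}(U(u),M(x))$ for all $u\in F(x,t)$ and adding, for all $u\in F(t,x)$ and $y$ with $U(u)\in M(y)$, the component $\mathrm{con}(U(u),(M(y)-U(\mathrm{pre}(t)))\cup U(\mathrm{post}(t)))$ with each token $a_i$ in it replaced by $(a_i,k,w)$, where $w$ is the variable with $U(w)=a_i$, or $*$ if there is none. **Causal-order reverse steps.** In $\langle M,H\rangle$, $(t,k)\prec(t',k')$ means that both are occurrences, $k<k'$, and some token $a_i$ of $M$ has $(a_j,k,u)\,\overline\in\,a_i$ and $(a_j',k',u')\,\overline\in\,a_i$ for some $a_j,a_j',u,u'$. We write $\langle M,H\rangle\xrightarrow{(\underline{t,k})}\langle M',H'\rangle$ if $k\in H(t)$, no occurrence $(t',k')$ has $(t,k)\prec(t',k')$, and there is an injective $U:A_V\cap\mathrm{post}(t)\to$ instances such that for $u\in F(t,x)$, $U(u)\in M(x)$ has the type of $u$ and the form $(a_i,k,u)$, and for $(u,v)\in F(t,x)$, $(U(u),U(v))\in M(x)$.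 Then $H'$ is $H$ with $k$ removed from $H(t)$, and $M'(x)$ is obtained from $M(x)$ by removing $\mathrm{con}(U(u),M(x))$ for all $u\in F(t,x)$ and adding, for all $u\in F(x,t)$ and $y$ with $U(u)\in M(y)$, all tokens $a_i$ such that some $(a_i,k,w)$, and all bonds $(a_i,b_i)$ such that some $((a_i,k,w),(b_i,k,w'))$, lies in $\mathrm{con}(U(u),(M(y)-U(\mathrm{post}(t)))\cup U(\mathrm{pre}(t)))$. An execution is a finite sequence of forward and causal-order reverse steps. **Equivalent states.** A causal path in a state is a nonempty sequence of occurrences $(t_1,k_1)\prec\dots\prec(t_n,k_n)$. $H\asymp H'$ means that for each causal path $(t_1,k_1),\dots,(t_n,k_n)$ in $\langle M,H\rangle$ there is a causal path $(t_1,k_1'),\dots,(t_n,k_n')$ in $\langle M',H'\rangle$, and vice versa. $M\asymp M'$ means that the markings agree up to keys: there is a bijection $\varphi$ of $\mathbb N$ with $k\in H(t)\iff\varphi(k)\in H'(t)$ for all $t,k$, such that for every place $x$ renaming all keys in $M(x)$ by $\varphi$ gives $M'(x)$. $\langle M,H\rangle\asymp\langle M',H'\rangle$ means $M\asymp M'$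 and $H\asymp H'$. **Equivalent executions.** Two steps perform the same action if they have the same direction and the same transition and assign to each variable tokens of the same origin. Steps $\alpha_1,\alpha_2$ from one state are concurrent if after each of them the action of the other can be performed, so that the two orders lead to $\asymp$-equivalent states. Causal equivalence of executions from the same state is the least equivalence relation such that (i) $\alpha_1;\alpha_2$ and $\alpha_2;\alpha_1$ are equivalent for concurrent $\alpha_1,\alpha_2$ (keys being adapted); (ii) $(t,k);(\underline{t,k})$ is equivalent to the empty execution; (iii) $(\underline{t,k_1});(t,k_2)$ is equivalent to the empty execution if whenever $(a_i,k_1,u)$, with $u$ a variable of $t$, is in place $x$ before the two steps, $(a_i,k_2,u)$ is in $x$ after them; and which is closed under composition: if $e_1,e_2$ are equivalent and $f_1,f_2$ continue them by the same sequence of actions, then $c;e_1;f_1$ and $c;e_2;f_2$ are equivalent for every execution $c$ that they can continue. **Theorem.** Consider a well-formed MRPN, a state $\langle M,H\rangle$ reachable from an initial state by an execution, and executions from $\langle M,H\rangle$ to $\langle M_1,H_1\rangle$ and to $\langle M_2,H_2\rangle$. These are causally equivalent executions if and only if $\langle M_1,H_1\rangle\asymp\langle M_2,H_2\rangle$. 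-/

import Mathlib

namespace MultiRPN

/-- An item over `X` is an element of `X` or an undirected bond between elements of `X`.
Arc labels are sets of items over the token variables; markings assign to each place a set of
items over the token instances. -/
abbrev Item (X : Type*) := X ⊕ Sym2 X

/-- Apply a renaming to an element, or to both ends of a bond. -/
def Item.map {X Y : Type*} (f : X → Y) : Item X → Item Y := Sum.map f (Sym2.map f)

/-- Token instances: `base a i` is the initial instance `(a, *, i)`, and `mem b k u` is the
instance `(b, k, u)`: the instance `b` after taking part in a transition occurrence with key `k`,
in the role of the variable `u`, where `none` stands for `*` (moved along, not selected). -/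
inductive Tok (A V : Type*) where
  | base (a : A) (i : ℕ) : Tok A V
  | mem (b : Tok A V) (k : ℕ) (u : Option V) : Tok A V

namespace Tok
variable {A V : Type*}

/-- The type of a token instance. -/
def ty : Tok A V → A
  | base a _ => a
  | mem b _ _ => b.ty

/-- The initial instance `(a, *, i)` from which an instance has evolved. -/
def origin : Tok A V → A × ℕ
  | base a i => (a, i)
  | mem b _ _ => b.origin

/-- `EvolvedTo a b`: the instance `a` has evolved to `b`, that is, `b` is `a` with possibly more
memories added. -/
inductive EvolvedTo (a : Tok A V) : Tok A V → Prop
  | refl : EvolvedTo a a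
  | mem {b : Tok A V} (k : ℕ) (u : Option V) (h : EvolvedTo a b) : EvolvedTo a (.mem b k u)

/-- Rename all the keys in the memory of an instance. -/
def rekey (φ : ℕ → ℕ) : Tok A V → Tok A V
  | base a i => base a i
  | mem b k u => mem (b.rekey φ) (φ k) u

end Tok

/-- The tokens `b, c` are joined by a bond of `C`, and `c` is in `C`. -/
def Linked {X : Type*} (C : Set (Item X)) (b c : X) : Prop :=
  Sum.inr s(b, c) ∈ C ∧ Sum.inl c ∈ C

/-- The connected component of `a` in `C`: the tokens of `C` connected to `a` via sequences of
bonds of `C`, together with the bonds creating these connections. -/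
def con {X : Type*} (a : X) (C : Set (Item X)) : Set (Item X) :=
  {e | (∃ b, e = Sum.inl b ∧ Sum.inl b ∈ C ∧ Relation.ReflTransGen (Linked C) a b) ∨
       (∃ b c, e = Sum.inr s(b, c) ∧ Relation.ReflTransGen (Linked C) a b ∧ Linked C b c)}

/-- A multi reversing Petri net with places `P`, transitions `T`, token types `A` and token
variables `V`; `inArc x t` is `F(x, t)` and `outArc t x` is `F(t, x)`. If a bond occurs on an arc
then so do its two ends, and it is of a bond type of the net. -/
structure MRPN (P T A V : Type*) where
  varTy : V → A
  bondTy : Set (Sym2 A)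
  inArc : P → T → Set (Item V)
  outArc : T → P → Set (Item V)
  inArc_bond : ∀ x t u v, Sum.inr s(u, v) ∈ inArc x t →
    Sum.inl u ∈ inArc x t ∧ Sum.inl v ∈ inArc x t ∧ s(varTy u, varTy v) ∈ bondTy
  outArc_bond : ∀ t x u v, Sum.inr s(u, v) ∈ outArc t x →
    Sum.inl u ∈ outArc t x ∧ Sum.inl v ∈ outArc t x ∧ s(varTy u, varTy v) ∈ bondTy

/-- A state `⟨M, H⟩`: a marking and a history. -/
@[ext] structure State (P T A V : Type*) where
  M : P → Set (Item (Tok A V))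
  H : T → Set ℕ

/-- Actions: the forward occurrence `(t, k)`, or its reversal. -/
inductive Action (T : Type*) where
  | fwd (t : T) (k : ℕ) : Action T
  | rev (t : T) (k : ℕ) : Action T

namespace MRPN
variable {P T A V : Type*} (N : MRPN P T A V)

/-- The variables on the incoming arcs of `t`. -/
def guardVars (t : T) : Set V := {u | ∃ x, Sum.inl u ∈ N.inArc x t}

/-- The variables on the outgoing arcs of `t`. -/
def effectVars (t : T) : Set V := {u | ∃ x, Sum.inl u ∈ N.outArc t x}

/-- Transitions neither erase nor create tokens, and do not send a token to two places. -/
def WellFormed : Prop :=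
  ∀ t, N.guardVars t = N.effectVars t ∧
    ∀ x y u, x ≠ y → ¬ (Sum.inl u ∈ N.outArc t x ∧ Sum.inl u ∈ N.outArc t y)

/-- Initial states: all tokens are initial instances, each in at most one place; the ends of a
bond lie in the same place as the bond, whose type is a bond type; the history is empty. -/
structure Initial (S : State P T A V) : Prop where
  base : ∀ x a, Sum.inl a ∈ S.M x → ∃ b i, a = Tok.base b i
  unique : ∀ a x y, Sum.inl a ∈ S.M x → Sum.inl a ∈ S.M y → x = y
  bond : ∀ x a b, Sum.inr s(a, b) ∈ S.M x →
    Sum.inl a ∈ S.M x ∧ Sum.inl b ∈ S.M x ∧ s(a.ty, b.ty) ∈ N.bondTy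
  hist : ∀ t, S.H t = ∅

/-- The token and bond instances required on the incoming arcs of `t` under the assignment `U`.
Only the values of an assignment on the variables of `t` matter. -/
def preItems (t : T) (U : V → Tok A V) : Set (Item (Tok A V)) :=
  {e | ∃ x, ∃ l ∈ N.inArc x t, e = Item.map U l}

/-- The token and bond instances on the outgoing arcs of `t` under the assignment `U`. -/
def postItems (t : T) (U : V → Tok A V) : Set (Item (Tok A V)) :=
  {e | ∃ x, ∃ l ∈ N.outArc t x, e = Item.map U l}

/-- `U` is a forward enabling assignment for `t` in `S`. -/
structure FwdEnabled (S : State P T A V) (t : T) (U : V → Tok A V) : Prop where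
  inj : Set.InjOn U (N.guardVars t)
  tokens : ∀ x u, Sum.inl u ∈ N.inArc x t → Sum.inl (U u) ∈ S.M x ∧ N.varTy u = (U u).ty
  bonds : ∀ x u v, Sum.inr s(u, v) ∈ N.inArc x t → Sum.inr s(U u, U v) ∈ S.M x
  noRecreate : ∀ x u v, Sum.inl u ∈ N.inArc x t → Sum.inl v ∈ N.inArc x t →
    Sum.inr s(U u, U v) ∈ S.M x → Sum.inr s(u, v) ∈ N.inArc x t
  noClone : ∀ u v y₁ y₂, y₁ ≠ y₂ → Sum.inl u ∈ N.outArc t y₁ → Sum.inl v ∈ N.outArc t y₂ →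
    ∀ x, (N.inArc x t).Nonempty →
      Sum.inl (U u) ∉ con (U v) ((S.M x \ N.preItems t U) ∪ N.postItems t U)

/-- Items removed from place `x` by the forward firing of `t`. -/
def fwdIn (S : State P T A V) (t : T) (U : V → Tok A V) (x : P) : Set (Item (Tok A V)) :=
  {e | ∃ u, Sum.inl u ∈ N.inArc x t ∧ e ∈ con (U u) (S.M x)}

/-- Items sent to place `x` by the forward firing of `t`, before memories are extended. -/
def fwdOut (S : State P T A V) (t : T) (U : V → Tok A V) (x : P) : Set (Item (Tok A V)) :=
  {e | ∃ u y, Sum.inl u ∈ N.outArc t x ∧ Sum.inl (U u) ∈ S.M y ∧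
    e ∈ con (U u) ((S.M y \ N.preItems t U) ∪ N.postItems t U)}

open Classical in
/-- The variable of `t` to which the instance `a` is assigned by `U`, or `none` (for `*`). -/
noncomputable def role (t : T) (U : V → Tok A V) (a : Tok A V) : Option V :=
  if h : ∃ u ∈ N.guardVars t, U u = a then some h.choose else none

/-- `⟨M, H⟩ -(t,k)-> ⟨M', H'⟩`, the forward execution of `t` with the assignment `U`. -/
structure FwdStepWith (S : State P T A V) (t : T) (k : ℕ) (U : V → Tok A V)
    (S' : State P T A V) : Prop where
  enabled : N.FwdEnabled S t U
  key : ∃ m, IsGreatest ({0} ∪ {k' | ∃ t', k' ∈ S.H t'}) m ∧ k = m + 1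
  marking : ∀ x, S'.M x = (S.M x \ N.fwdIn S t U x) ∪
    Item.map (fun a => Tok.mem a k (N.role t U a)) '' N.fwdOut S t U x
  hist : ∀ t', S'.H t' = {k' | k' ∈ S.H t' ∨ (t' = t ∧ k' = k)}

/-- `(t', k')` causally depends on `(t, k)` in `S`. -/
def Prec (S : State P T A V) (o o' : T × ℕ) : Prop :=
  o.2 ∈ S.H o.1 ∧ o'.2 ∈ S.H o'.1 ∧ o.2 < o'.2 ∧
    ∃ x a b u b' u', Sum.inl a ∈ S.M x ∧
      Tok.EvolvedTo (Tok.mem b o.2 u) a ∧ Tok.EvolvedTo (Tok.mem b' o'.2 u') a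

/-- The occurrence `(t, k)` is c-enabled in `S`, with the causal enabling assignment `U`. -/
structure RevEnabled (S : State P T A V) (t : T) (k : ℕ) (U : V → Tok A V) : Prop where
  occ : k ∈ S.H t
  last : ∀ o', ¬ Prec S (t, k) o'
  inj : Set.InjOn U (N.effectVars t)
  tokens : ∀ x u, Sum.inl u ∈ N.outArc t x →
    (∃ a, U u = Tok.mem a k (some u)) ∧ Sum.inl (U u) ∈ S.M x ∧ N.varTy u = (U u).ty
  bonds : ∀ x u v, Sum.inr s(u, v) ∈ N.outArc t x → Sum.inr s(U u, U v) ∈ S.M x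

/-- Items removed from place `x` by the reversal of `t`. -/
def revIn (S : State P T A V) (t : T) (U : V → Tok A V) (x : P) : Set (Item (Tok A V)) :=
  {e | ∃ u, Sum.inl u ∈ N.outArc t x ∧ e ∈ con (U u) (S.M x)}

/-- Items sent to place `x` by the reversal of `t`, before memories are shortened. -/
def revOut (S : State P T A V) (t : T) (U : V → Tok A V) (x : P) : Set (Item (Tok A V)) :=
  {e | ∃ u y, Sum.inl u ∈ N.inArc x t ∧ Sum.inl (U u) ∈ S.M y ∧
    e ∈ con (U u) ((S.M y \ N.postItems t U) ∪ N.preItems t U)}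

/-- The causal-order reversal of the occurrence `(t, k)`, with the assignment `U`. -/
structure RevStepWith (S : State P T A V) (t : T) (k : ℕ) (U : V → Tok A V)
    (S' : State P T A V) : Prop where
  enabled : N.RevEnabled S t k U
  marking : ∀ x, S'.M x = (S.M x \ N.revIn S t U x) ∪
    ({e | ∃ a u, e = Sum.inl a ∧ Sum.inl (Tok.mem a k u) ∈ N.revOut S t U x} ∪
     {e | ∃ a u b v, e = Sum.inr s(a, b) ∧
        Sum.inr s(Tok.mem a k u, Tok.mem b k v) ∈ N.revOut S t U x})
  hist : ∀ t', S'.H t' = {k' | k' ∈ S.H t' ∧ ¬ (t' = t ∧ k' = k)}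

/-- One forward or causal-order reverse step. -/
def Step (S : State P T A V) : Action T → State P T A V → Prop
  | .fwd t k, S' => ∃ U, N.FwdStepWith S t k U S'
  | .rev t k, S' => ∃ U, N.RevStepWith S t k U S'

/-- Executions: finite sequences of forward and causal-order reverse steps. -/
inductive Exec : State P T A V → State P T A V → Type _
  | nil (S : State P T A V) : Exec S S
  | cons {S S' S'' : State P T A V} (α : Action T) (h : N.Step S α S') (e : Exec S' S'') :
      Exec S S''

/-- Composition of executions. -/
def Exec.comp {N : MRPN P T A V} {S S' S'' : State P T A V} :
    N.Exec S S' → N.Exec S' S'' → N.Exec S S''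
  | .nil _, f => f
  | .cons α h e, f => .cons α h (e.comp f)

/-- A state is reachable if some execution leads to it from an initial state. -/
def Reachable (S : State P T A V) : Prop := ∃ S₀, N.Initial S₀ ∧ Nonempty (N.Exec S₀ S)

/-- A causal path: a nonempty sequence of transition occurrences, each causing the next. -/
def CausalPath (S : State P T A V) (p : List (T × ℕ)) : Prop :=
  p ≠ [] ∧ (∀ o ∈ p, o.2 ∈ S.H o.1) ∧ p.IsChain (Prec S)

/-- Causal equivalence of histories: the same causal paths, up to keys. -/
def HistEquiv (S S' : State P T A V) : Prop :=
  (∀ p, CausalPath S p → ∃ q, CausalPath S' q ∧ q.map Prod.fst = p.map Prod.fst) ∧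
  (∀ q, CausalPath S' q → ∃ p, CausalPath S p ∧ p.map Prod.fst = q.map Prod.fst)

/-- Causal equivalence of markings: the same token and bond instances in the same places, having
taken part in the same transitions, up to the choice of keys: one renaming of keys carries the
occurrences of each transition to occurrences of it, and one marking to the other. -/
def MarkEquiv (S S' : State P T A V) : Prop :=
  ∃ φ : Equiv.Perm ℕ, (∀ t k, k ∈ S.H t ↔ φ k ∈ S'.H t) ∧
    ∀ x, S'.M x = Item.map (Tok.rekey φ) '' S.M x

/-- Causal equivalence of states. -/
def StateEquiv (S S' : State P T A V) : Prop := MarkEquiv S S' ∧ HistEquiv S S'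

/-- Occurrences `(t, k₁)` and `(t, k₂)`, performed in markings `M₁` and `M₂`, are equivalent: the
same token instances have been assigned to the variables of `t`. -/
def EquivOcc (t : T) (M₁ : P → Set (Item (Tok A V))) (k₁ : ℕ)
    (M₂ : P → Set (Item (Tok A V))) (k₂ : ℕ) : Prop :=
  ∀ x a, ∀ u ∈ N.guardVars t, Sum.inl (Tok.mem a k₁ (some u)) ∈ M₁ x →
    Sum.inl (Tok.mem a k₂ (some u)) ∈ M₂ x

/-- In `M`, the token with origin `o` has been assigned to the variable `u` of `t` by the
occurrence with key `k`, as its latest memory. -/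
def Uses (t : T) (M : P → Set (Item (Tok A V))) (k : ℕ) (u : V) (o : A × ℕ) : Prop :=
  u ∈ N.guardVars t ∧ ∃ x a, a.origin = o ∧ Sum.inl (Tok.mem a k (some u)) ∈ M x

/-- The steps `S₁ -α-> S₁'` and `S₂ -β-> S₂'` perform the same action up to keys: the same
transition in the same direction, manipulating the same tokens in the same roles. (The memory of
an occurrence is found after a forward step and before a reverse step.) -/
def SameAction (S₁ : State P T A V) (α : Action T) (S₁' S₂ : State P T A V) (β : Action T)
    (S₂' : State P T A V) : Prop :=
  match α, β with
  | .fwd t k, .fwd t' k' => t = t' ∧ ∀ u o, N.Uses t S₁'.M k u o ↔ N.Uses t S₂'.M k' u o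
  | .rev t k, .rev t' k' => t = t' ∧ ∀ u o, N.Uses t S₁.M k u o ↔ N.Uses t S₂.M k' u o
  | _, _ => False

/-- The actions of the steps `S -α₁-> S₁` and `S -α₂-> S₂` are concurrent in `S`: each can be
followed by the other, and the two orders lead to causally equivalent states. -/
def Concurrent (S : State P T A V) (α₁ : Action T) (S₁ : State P T A V) (α₂ : Action T)
    (S₂ : State P T A V) : Prop :=
  ∃ β₂ S' β₁ S'', N.Step S₁ β₂ S' ∧ N.SameAction S α₂ S₂ S₁ β₂ S' ∧
    N.Step S₂ β₁ S'' ∧ N.SameAction S α₁ S₁ S₂ β₁ S'' ∧ StateEquiv S' S''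

/-- Two executions perform the same sequence of actions up to keys. -/
inductive SameTrace : ∀ {S₁ S₁' S₂ S₂' : State P T A V}, N.Exec S₁ S₁' → N.Exec S₂ S₂' → Prop
  | nil (S₁ S₂ : State P T A V) : SameTrace (.nil S₁) (.nil S₂)
  | cons {S₁ R₁ S₁' S₂ R₂ S₂' : State P T A V} {α β : Action T}
      (h₁ : N.Step S₁ α R₁) (h₂ : N.Step S₂ β R₂) {e₁ : N.Exec R₁ S₁'} {e₂ : N.Exec R₂ S₂'}
      (h : N.SameAction S₁ α R₁ S₂ β R₂) (he : SameTrace e₁ e₂) :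
      SameTrace (.cons α h₁ e₁) (.cons β h₂ e₂)

/-- Causal equivalence of executions from the same state: the least equivalence relation closed
under composition (with a common execution before, and with the same actions, up to keys, after)
such that concurrent actions may be swapped, an occurrence followed by its reversal may be
cancelled, and so may a reversal followed by an equivalent forward occurrence. -/
inductive CausEq : ∀ {S S₁ S₂ : State P T A V}, N.Exec S S₁ → N.Exec S S₂ → Prop
  | refl {S S₁ : State P T A V} (e : N.Exec S S₁) : CausEq e e
  | symm {S S₁ S₂ : State P T A V} {e₁ : N.Exec S S₁} {e₂ : N.Exec S S₂} :
      CausEq e₁ e₂ → CausEq e₂ e₁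
  | trans {S S₁ S₂ S₃ : State P T A V} {e₁ : N.Exec S S₁} {e₂ : N.Exec S S₂}
      {e₃ : N.Exec S S₃} : CausEq e₁ e₂ → CausEq e₂ e₃ → CausEq e₁ e₃
  | comp {S₀ S S₁ S₂ S₁' S₂' : State P T A V} (c : N.Exec S₀ S) {e₁ : N.Exec S S₁}
      {e₂ : N.Exec S S₂} {f₁ : N.Exec S₁ S₁'} {f₂ : N.Exec S₂ S₂'} :
      CausEq e₁ e₂ → N.SameTrace f₁ f₂ → CausEq (c.comp (e₁.comp f₁)) (c.comp (e₂.comp f₂))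
  | swap {S S₁ S₂ S' S'' : State P T A V} {α₁ α₂ β₁ β₂ : Action T}
      (h₁ : N.Step S α₁ S₁) (k₂ : N.Step S₁ β₂ S') (h₂ : N.Step S α₂ S₂)
      (k₁ : N.Step S₂ β₁ S'') (hc : N.Concurrent S α₁ S₁ α₂ S₂)
      (s₂ : N.SameAction S α₂ S₂ S₁ β₂ S') (s₁ : N.SameAction S α₁ S₁ S₂ β₁ S'') :
      CausEq (.cons α₁ h₁ (.cons β₂ k₂ (.nil S'))) (.cons α₂ h₂ (.cons β₁ k₁ (.nil S'')))
  | cancelFwdRev {S S' S'' : State P T A V} {t : T} {k : ℕ}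
      (h : N.Step S (.fwd t k) S') (h' : N.Step S' (.rev t k) S'') :
      CausEq (.cons _ h (.cons _ h' (.nil S''))) (.nil S)
  | cancelRevFwd {S S' S'' : State P T A V} {t : T} {k₁ k₂ : ℕ}
      (h : N.Step S (.rev t k₁) S') (h' : N.Step S' (.fwd t k₂) S'')
      (heq : N.EquivOcc t S.M k₁ S''.M k₂) :
      CausEq (.cons _ h (.cons _ h' (.nil S''))) (.nil S)

end MRPN

end MultiRPN

/-! Keys are only names, so states are compared up to a permutation of keys. In the states that
occur, memories are added in increasing order of keys; a renaming between two such states therefore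
preserves the order of keys inside each token, the condition on causal paths becomes automatic, and
state equivalence just says that one state is a renaming of the other (`stateEquiv_iff`).

A step rearranges connected components and stamps the tokens that it takes. Two features of the
rearrangement (`Move`) carry the proof. It is reversible: no bond between selected tokens is
recreated and no component is sent to two places, so the opposite replacement restores what was
taken (`Move.reverse`, `Move.moved_reverse`). It is local: components sharing no token with those
taken have no influence (`Move.union`, `Move.of_union`, `moved_union`). Reversibility gives
`LStep.undo` and `LStep.rev_eq`; locality gives the exchange of independent steps, `LStep.swap`.

A causal-order reversal may undo an occurrence whose key is not the largest. Hence forward steps are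
studied with arbitrary fresh keys (`LStep`): by repeated exchange, an occurrence on which nothing
depends becomes the last one (`LReach.pull`), and every reversal is the exact inverse of such a
step. So every reachable state is the result of a purely forward run with fresh keys.

Equivalent executions end in states that agree up to keys because the effect of an action is
determined, up to keys, by its transition and the origins of the tokens selected (`CausEq.rekey`).
The converse, `causEq_of_rekey`, is by induction on a forward run leading to the first final state.
Reversing the last occurrence of that run at the end of both executions gives executions to which
the induction hypothesis applies; redoing the occurrence in both preserves equivalence, and each
reversal cancels against its redo. In the base case both final histories are empty. Such executions
can be rewritten with reversals only (`Exec.exists_allRev`), and any two ways of undoing everything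
are equivalent by a diamond argument (`causEq_of_allRev`). -/

namespace MultiRPN

open Relation (ReflTransGen)

/-! ### Sets of items and their connected components -/

section Components
variable {X Y P : Type*}

theorem Item.map_comp {Z : Type*} (g : Y → Z) (f : X → Y) (e : Item X) :
    Item.map g (Item.map f e) = Item.map (fun a => g (f a)) e := by
  rcases e with a | ⟨a, b⟩ <;> rfl

theorem Item.map_injective {f : X → Y} (hf : f.Injective) : (Item.map f).Injective :=
  Sum.map_injective.2 ⟨hf, Sym2.map.injective hf⟩

theorem Item.inl_mem_image {f : X → Y} {C : Set (Item X)} {b : Y} :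
    Sum.inl b ∈ Item.map f '' C ↔ ∃ a, b = f a ∧ Sum.inl a ∈ C := by
  constructor
  · rintro ⟨a | ⟨a, c⟩, h, h'⟩
    · exact ⟨a, (Sum.inl.inj h').symm, h⟩
    · cases h'
  · rintro ⟨a, rfl, h⟩
    exact ⟨_, h, rfl⟩

theorem Item.inr_mem_image {f : X → Y} {C : Set (Item X)} {b d : Y} :
    Sum.inr s(b, d) ∈ Item.map f '' C ↔ ∃ a c, b = f a ∧ d = f c ∧ Sum.inr s(a, c) ∈ C := by
  constructor
  · rintro ⟨a | ⟨a, c⟩, h, h'⟩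
    · cases h'
    · have h2 : s(f a, f c) = s(b, d) := Sum.inr.inj h'
      rcases Sym2.eq_iff.1 h2 with ⟨rfl, rfl⟩ | ⟨rfl, rfl⟩
      · exact ⟨a, c, rfl, rfl, h⟩
      · exact ⟨c, a, rfl, rfl, by rw [Sym2.eq_swap]; exact h⟩
  · rintro ⟨a, c, rfl, rfl, h⟩
    exact ⟨_, h, rfl⟩

theorem item_ext {C D : Set (Item X)} (h₁ : ∀ a, Sum.inl a ∈ C ↔ Sum.inl a ∈ D)
    (h₂ : ∀ a b, Sum.inr s(a, b) ∈ C ↔ Sum.inr s(a, b) ∈ D) : C = D := by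
  ext e
  rcases e with a | ⟨a, b⟩
  · exact h₁ a
  · exact h₂ a b

/-- A set of items that contains the ends of its bonds. -/
def Closed (C : Set (Item X)) : Prop := ∀ a b, Sum.inr s(a, b) ∈ C → Sum.inl a ∈ C

theorem Closed.right {C : Set (Item X)} (hC : Closed C) {a b : X} (h : Sum.inr s(a, b) ∈ C) :
    Sum.inl b ∈ C := hC b a (by rwa [Sym2.eq_swap])

/-- Connectedness through the bonds of `C`. -/
abbrev Conn (C : Set (Item X)) : X → X → Prop := ReflTransGen (Linked C)

theorem Conn.mono {C D : Set (Item X)} (h : C ⊆ D) {a b : X} (hc : Conn C a b) : Conn D a b :=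
  hc.lift id fun _ _ hl => ⟨h hl.1, h hl.2⟩

theorem Conn.symm {C : Set (Item X)} (hC : Closed C) {a b : X} (h : Conn C a b) : Conn C b a := by
  induction h with
  | refl => exact .refl
  | tail _ h ih =>
    exact .head ⟨by rw [Sym2.eq_swap]; exact h.1, hC _ _ h.1⟩ ih

theorem inl_mem_con {C : Set (Item X)} {a b : X} :
    Sum.inl b ∈ con a C ↔ Sum.inl b ∈ C ∧ Conn C a b := by
  constructor
  · rintro (⟨c, h, h'⟩ | ⟨c, d, h, -⟩)
    · cases h; exact h'
    · cases h
  · exact fun h => Or.inl ⟨b, rfl, h⟩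

theorem inr_mem_con {C : Set (Item X)} (hC : Closed C) {a b c : X} :
    Sum.inr s(b, c) ∈ con a C ↔ Sum.inr s(b, c) ∈ C ∧ Conn C a b := by
  constructor
  · rintro (⟨d, h, -⟩ | ⟨d, e, h, h1, h2⟩)
    · cases h
    · rcases Sym2.eq_iff.1 (Sum.inr.inj h) with ⟨rfl, rfl⟩ | ⟨rfl, rfl⟩
      · exact ⟨h2.1, h1⟩
      · exact ⟨by rw [Sym2.eq_swap]; exact h2.1, h1.tail h2⟩
  · exact fun h => Or.inr ⟨b, c, rfl, h.2, h.1, hC.right h.1⟩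

theorem con_subset {C : Set (Item X)} {a : X} : con a C ⊆ C := by
  rintro e (⟨c, rfl, h, -⟩ | ⟨c, d, rfl, -, h⟩)
  exacts [h, h.1]

theorem con_mono {C D : Set (Item X)} (h : C ⊆ D) (a : X) : con a C ⊆ con a D := by
  rintro e (⟨c, rfl, h1, h2⟩ | ⟨c, d, rfl, h1, h2⟩)
  · exact Or.inl ⟨c, rfl, h h1, Conn.mono h h2⟩
  · exact Or.inr ⟨c, d, rfl, Conn.mono h h1, h h2.1, h h2.2⟩

theorem Conn.of_con {C : Set (Item X)} {a b : X} (h : Conn C a b) : Conn (con a C) a b := by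
  induction h with
  | refl => exact .refl
  | tail h1 h2 ih =>
    exact ih.tail ⟨Or.inr ⟨_, _, rfl, h1, h2⟩, inl_mem_con.2 ⟨h2.2, h1.tail h2⟩⟩

/-- Components only depend on the items around the tokens that can be reached. -/
theorem con_subset_of_agree {C D : Set (Item X)} (W : Set X) {a : X} (ha : a ∈ W)
    (htok : ∀ b ∈ W, Sum.inl b ∈ C → Sum.inl b ∈ D)
    (hbond : ∀ b ∈ W, ∀ c, Sum.inr s(b, c) ∈ C → Sum.inr s(b, c) ∈ D ∧ c ∈ W) :
    con a C ⊆ con a D := by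
  have key : ∀ b, Conn C a b → b ∈ W ∧ Conn D a b := by
    intro b h
    induction h with
    | refl => exact ⟨ha, .refl⟩
    | tail _ h ih =>
      obtain ⟨h1, h2⟩ := hbond _ ih.1 _ h.1
      exact ⟨h2, ih.2.tail ⟨h1, htok _ h2 h.2⟩⟩
  rintro e (⟨c, rfl, h1, h2⟩ | ⟨c, d, rfl, h1, h2⟩)
  · exact Or.inl ⟨c, rfl, htok _ (key _ h2).1 h1, (key _ h2).2⟩
  · obtain ⟨h3, h4⟩ := key _ h1
    obtain ⟨h5, h6⟩ := hbond _ h3 _ h2.1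
    exact Or.inr ⟨c, d, rfl, h4, h5, htok _ h6 h2.2⟩

/-- A path from `a` never leaves a region `W` closed under bonds, so agreement on `W` is enough. The
frame lemmas apply this with `W` the set of tokens of one part of a marking. -/
theorem con_congr {C D : Set (Item X)} (W : Set X) {a : X} (ha : a ∈ W)
    (htok : ∀ b ∈ W, Sum.inl b ∈ C ↔ Sum.inl b ∈ D)
    (hbond : ∀ b ∈ W, ∀ c, Sum.inr s(b, c) ∈ C ↔ Sum.inr s(b, c) ∈ D)
    (hW : ∀ b ∈ W, ∀ c, Sum.inr s(b, c) ∈ C → c ∈ W) : con a C = con a D :=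
  Set.Subset.antisymm
    (con_subset_of_agree W ha (fun b hb => (htok b hb).1)
      fun b hb c h => ⟨(hbond b hb c).1 h, hW b hb c h⟩)
    (con_subset_of_agree W ha (fun b hb => (htok b hb).2)
      fun b hb c h => ⟨(hbond b hb c).2 h, hW b hb c ((hbond b hb c).2 h)⟩)

/-- Injectivity prevents distinct tokens from being glued, so every path in the image lifts. This
serves both for renaming keys and for adding memories. -/
theorem con_image {f : X → Y} (hf : f.Injective) (a : X) (C : Set (Item X)) :
    con (f a) (Item.map f '' C) = Item.map f '' con a C := by
  have key : ∀ b', Conn (Item.map f '' C) (f a) b' → ∃ b, b' = f b ∧ Conn C a b := by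
    intro b' h
    induction h with
    | refl => exact ⟨a, rfl, .refl⟩
    | tail _ h ih =>
      obtain ⟨b, rfl, hb⟩ := ih
      obtain ⟨c, d, h1, rfl, h2⟩ := Item.inr_mem_image.1 h.1
      obtain ⟨d', h3, h4⟩ := Item.inl_mem_image.1 h.2
      cases hf h1
      cases hf h3
      exact ⟨_, rfl, hb.tail ⟨h2, h4⟩⟩
  have key' : ∀ b, Conn C a b → Conn (Item.map f '' C) (f a) (f b) := by
    intro b h
    exact h.lift f fun _ _ hl => ⟨⟨_, hl.1, rfl⟩, ⟨_, hl.2, rfl⟩⟩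
  apply Set.Subset.antisymm
  · rintro e (⟨c, rfl, h1, h2⟩ | ⟨c, d, rfl, h1, h2⟩)
    · obtain ⟨b, rfl, hb⟩ := key _ h2
      obtain ⟨b', h3, h4⟩ := Item.inl_mem_image.1 h1
      cases hf h3
      exact ⟨Sum.inl b, inl_mem_con.2 ⟨h4, hb⟩, rfl⟩
    · obtain ⟨b, rfl, hb⟩ := key _ h1
      obtain ⟨c, d, h3, rfl, h4⟩ := Item.inr_mem_image.1 h2.1
      obtain ⟨d', h5, h6⟩ := Item.inl_mem_image.1 h2.2
      cases hf h3
      cases hf h5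
      exact ⟨Sum.inr s(b, d), Or.inr ⟨b, d, rfl, hb, h4, h6⟩, rfl⟩
  · rintro _ ⟨e, ⟨c, rfl, h1, h2⟩ | ⟨c, d, rfl, h1, h2⟩, rfl⟩
    · exact Or.inl ⟨f c, rfl, ⟨_, h1, rfl⟩, key' _ h2⟩
    · exact Or.inr ⟨f c, f d, rfl, key' _ h1, ⟨_, h2.1, rfl⟩, ⟨_, h2.2, rfl⟩⟩

/-! ### Replacing items in a marking and moving the resulting components -/

/-- All the items of a family. -/
def total (M : P → Set (Item X)) : Set (Item X) := {e | ∃ x, e ∈ M x}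

/-- Markings in which bonds lie together with their ends and tokens lie in one place only. -/
structure Proper (M : P → Set (Item X)) : Prop where
  closed : ∀ x, Closed (M x)
  unique : ∀ a x y, Sum.inl a ∈ M x → Sum.inl a ∈ M y → x = y

/-- The components of `M` that contain a token of the label `I`. -/
def taken (M I : P → Set (Item X)) (x : P) : Set (Item X) :=
  {e | ∃ c, Sum.inl c ∈ I x ∧ e ∈ con c (M x)}

/-- The components that arise from `M` when the items of `I` are replaced by those of `O`, arranged
according to `O`. -/
def moved (M I O : P → Set (Item X)) (y : P) : Set (Item X) :=
  {e | ∃ c x, Sum.inl c ∈ O y ∧ Sum.inl c ∈ M x ∧ e ∈ con c ((M x \ total I) ∪ total O)}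

/-- The items of `I` can be replaced by those of `O` in the marking `M`. -/
structure Move (M I O : P → Set (Item X)) : Prop where
  proper : Proper M
  in_closed : ∀ x, Closed (I x)
  out_closed : ∀ x, Closed (O x)
  in_sub : ∀ x, I x ⊆ M x
  tok : ∀ a, Sum.inl a ∈ total I ↔ Sum.inl a ∈ total O
  out_unique : ∀ a x y, Sum.inl a ∈ O x → Sum.inl a ∈ O y → x = y
  noRec : ∀ x a b, Sum.inl a ∈ I x → Sum.inl b ∈ I x → Sum.inr s(a, b) ∈ M x →
    Sum.inr s(a, b) ∈ I x
  noClone : ∀ a b y₁ y₂, y₁ ≠ y₂ → Sum.inl a ∈ O y₁ → Sum.inl b ∈ O y₂ →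
    ∀ x, (I x).Nonempty → Sum.inl a ∉ con b ((M x \ total I) ∪ total O)

theorem total_closed {M : P → Set (Item X)} (h : ∀ x, Closed (M x)) : Closed (total M) :=
  fun _ _ ⟨x, hx⟩ => ⟨x, h x _ _ hx⟩

theorem total_image (f : X → Y) (M : P → Set (Item X)) :
    total (fun x => Item.map f '' M x) = Item.map f '' total M := by
  ext e
  constructor
  · rintro ⟨x, a, h, rfl⟩
    exact ⟨a, ⟨x, h⟩, rfl⟩
  · rintro ⟨a, ⟨x, h⟩, rfl⟩
    exact ⟨x, a, h, rfl⟩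

theorem Closed.image {C : Set (Item X)} (hC : Closed C) (f : X → Y) : Closed (Item.map f '' C) := by
  intro a b h
  obtain ⟨a, b, rfl, rfl, h'⟩ := Item.inr_mem_image.1 h
  exact ⟨_, hC _ _ h', rfl⟩

theorem Proper.image {M : P → Set (Item X)} (hM : Proper M) {f : X → Y} (hf : f.Injective) :
    Proper fun x => Item.map f '' M x where
  closed x := (hM.closed x).image f
  unique a x y h h' := by
    obtain ⟨a, rfl, h1⟩ := Item.inl_mem_image.1 h
    obtain ⟨b, e, h2⟩ := Item.inl_mem_image.1 h'
    cases hf e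
    exact hM.unique _ _ _ h1 h2

theorem taken_image {f : X → Y} (hf : f.Injective) (M I : P → Set (Item X)) (x : P) :
    taken (fun x => Item.map f '' M x) (fun x => Item.map f '' I x) x =
      Item.map f '' taken M I x := by
  ext e
  constructor
  · rintro ⟨c, h1, h2⟩
    obtain ⟨c, rfl, g1⟩ := Item.inl_mem_image.1 h1
    rw [con_image hf] at h2
    obtain ⟨d, h2, rfl⟩ := h2
    exact ⟨d, ⟨c, g1, h2⟩, rfl⟩
  · rintro ⟨d, ⟨c, h1, h2⟩, rfl⟩
    refine ⟨f c, ⟨_, h1, rfl⟩, ?_⟩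
    rw [con_image hf]
    exact ⟨d, h2, rfl⟩

theorem replace_image {f : X → Y} (hf : f.Injective) (M I O : P → Set (Item X)) (x : P) :
    (Item.map f '' M x \ total fun x => Item.map f '' I x) ∪ (total fun x => Item.map f '' O x) =
      Item.map f '' ((M x \ total I) ∪ total O) := by
  rw [total_image, total_image, Set.image_union, Set.image_sdiff (Item.map_injective hf)]

theorem moved_image {f : X → Y} (hf : f.Injective) (M I O : P → Set (Item X)) (x : P) :
    moved (fun x => Item.map f '' M x) (fun x => Item.map f '' I x)
      (fun x => Item.map f '' O x) x = Item.map f '' moved M I O x := by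
  ext e
  constructor
  · rintro ⟨c, y, h1, h2, h3⟩
    obtain ⟨c, rfl, g1⟩ := Item.inl_mem_image.1 h1
    obtain ⟨c', e, g2⟩ := Item.inl_mem_image.1 h2
    cases hf e
    rw [replace_image hf, con_image hf] at h3
    obtain ⟨d, h3, rfl⟩ := h3
    exact ⟨d, ⟨c, y, g1, g2, h3⟩, rfl⟩
  · rintro ⟨d, ⟨c, y, h1, h2, h3⟩, rfl⟩
    refine ⟨f c, y, ⟨_, h1, rfl⟩, ⟨_, h2, rfl⟩, ?_⟩
    rw [replace_image hf, con_image hf]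
    exact ⟨d, h3, rfl⟩

theorem Move.image {M I O : P → Set (Item X)} (h : Move M I O) {f : X → Y} (hf : f.Injective) :
    Move (fun x => Item.map f '' M x) (fun x => Item.map f '' I x)
      (fun x => Item.map f '' O x) where
  proper := h.proper.image hf
  in_closed x := (h.in_closed x).image f
  out_closed x := (h.out_closed x).image f
  in_sub x := Set.image_mono (h.in_sub x)
  tok a := by
    rw [total_image, total_image, Item.inl_mem_image, Item.inl_mem_image]
    simp only [h.tok]
  out_unique a x y h1 h2 := by
    obtain ⟨a, rfl, g1⟩ := Item.inl_mem_image.1 h1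
    obtain ⟨b, e, g2⟩ := Item.inl_mem_image.1 h2
    cases hf e
    exact h.out_unique _ _ _ g1 g2
  noRec x a b h1 h2 h3 := by
    obtain ⟨a, rfl, g1⟩ := Item.inl_mem_image.1 h1
    obtain ⟨b, rfl, g2⟩ := Item.inl_mem_image.1 h2
    obtain ⟨a', b', e1, e2, g3⟩ := Item.inr_mem_image.1 h3
    cases hf e1
    cases hf e2
    exact ⟨_, h.noRec x a b g1 g2 g3, rfl⟩
  noClone a b y₁ y₂ hne h1 h2 x hx h3 := by
    obtain ⟨a, rfl, g1⟩ := Item.inl_mem_image.1 h1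
    obtain ⟨b, rfl, g2⟩ := Item.inl_mem_image.1 h2
    rw [replace_image hf, con_image hf] at h3
    obtain ⟨a', e1, g3⟩ := Item.inl_mem_image.1 h3
    cases hf e1
    exact h.noClone a b y₁ y₂ hne g1 g2 x hx.of_image g3

/-! ### Locality and reversibility of a move -/

namespace Move
variable {M I O : P → Set (Item X)} (h : Move M I O)
include h

theorem mem_of_in {a : X} {x : P} (ha : Sum.inl a ∈ total I) (hx : Sum.inl a ∈ M x) :
    Sum.inl a ∈ I x := by
  obtain ⟨y, hy⟩ := ha
  exact h.proper.unique a y x (h.in_sub y hy) hx ▸ hy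

/-- A selected token deleted with `I` comes back with `O`, so no remaining bond loses an end. -/
theorem closed_replace {G : Set (Item X)} (hG : Closed G) : Closed ((G \ total I) ∪ total O) := by
  rintro a b (⟨h1, -⟩ | h1)
  · by_cases ha : Sum.inl a ∈ total I
    · exact Or.inr ((h.tok a).1 ha)
    · exact Or.inl ⟨hG _ _ h1, ha⟩
  · exact Or.inr (total_closed h.out_closed _ _ h1)

theorem tok_mem_replace {G : Set (Item X)} {a : X} (ha : Sum.inl a ∈ G) :
    Sum.inl a ∈ (G \ total I) ∪ total O := by
  by_cases ha' : Sum.inl a ∈ total I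
  · exact Or.inr ((h.tok a).1 ha')
  · exact Or.inl ⟨ha, ha'⟩

/-- A path through the union of all places can change its place only at a token of `O` or along a
bond of `O`. By `noClone` the tokens of `O` met on the way all go to `y`, so at each change the path
can be restarted from such a token, inside a single place. -/
theorem local_of_conn {y : P} {c b : X} (hc : Sum.inl c ∈ O y)
    (hb : Conn ((total M \ total I) ∪ total O) c b) :
    ∃ c' x, Sum.inl c' ∈ O y ∧ Sum.inl c' ∈ M x ∧ Conn ((M x \ total I) ∪ total O) c' b := by
  have start : ∀ c, Sum.inl c ∈ O y →
      ∃ c' x, Sum.inl c' ∈ O y ∧ Sum.inl c' ∈ M x ∧ Conn ((M x \ total I) ∪ total O) c' c := by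
    intro c hc
    obtain ⟨x, hx⟩ := (h.tok c).2 ⟨y, hc⟩
    exact ⟨c, x, hc, h.in_sub x hx, .refl⟩
  induction hb with
  | refl => exact start c hc
  | @tail b d _ hl ih =>
    obtain ⟨c', x, h1, h2, h3⟩ := ih
    -- The restart token `c'` is selected and lies in `x`, so `I x` is nonempty and `noClone`
    -- applies at `x`.
    have same : ∀ y', Sum.inl b ∈ O y' → y' = y := by
      intro y' hy'
      by_contra hne
      exact h.noClone b c' y' y hne hy' h1 x ⟨_, h.mem_of_in ((h.tok c').2 ⟨y, h1⟩) h2⟩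
        (inl_mem_con.2 ⟨Or.inr ⟨y', hy'⟩, h3⟩)
    rcases hl.1 with ⟨⟨x', hx'⟩, hI⟩ | ⟨y', hy'⟩
    · have hb' := h.proper.closed x' _ _ hx'
      have hd' := (h.proper.closed x').right hx'
      have link : Linked ((M x' \ total I) ∪ total O) b d :=
        ⟨Or.inl ⟨hx', hI⟩, h.tok_mem_replace hd'⟩
      by_cases hb : Sum.inl b ∈ M x
      · cases h.proper.unique b x x' hb hb'
        exact ⟨c', x, h1, h2, h3.tail link⟩
      -- Here `b` was reached in the modified place `x` without belonging to `M x`, so it must have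
      -- come from `O`.
      · have hbO : Sum.inl b ∈ total O := by
          rcases h3.cases_tail with rfl | ⟨e, -, he⟩
          · exact ⟨y, h1⟩
          · rcases he.2 with he | he
            · exact absurd he.1 hb
            · exact he
        obtain ⟨y', hy'⟩ := hbO
        cases same y' hy'
        exact ⟨b, x', hy', hb', .single link⟩
    · cases same y' (h.out_closed y' _ _ hy')
      exact start d ((h.out_closed _).right hy')

/-- This is `noClone` freed from the place in which connectedness is tested; it makes the
destination of a component unambiguous. -/
theorem out_eq_of_conn {y y' : P} {c b : X} (hc : Sum.inl c ∈ O y) (hb' : Sum.inl b ∈ O y')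
    (hb : Conn ((total M \ total I) ∪ total O) c b) : y = y' := by
  obtain ⟨c', x, h1, h2, h3⟩ := h.local_of_conn hc hb
  by_contra hne
  exact h.noClone b c' y' y (Ne.symm hne) hb' h1 x
    ⟨_, h.mem_of_in ((h.tok c').2 ⟨_, h1⟩) h2⟩ (inl_mem_con.2 ⟨Or.inr ⟨_, hb'⟩, h3⟩)

theorem total_proper_closed : Closed ((total M \ total I) ∪ total O) :=
  h.closed_replace (total_closed h.proper.closed)

/-- The moved components can be computed in the union of all places. -/
theorem mem_moved {y : P} {e : Item X} :
    e ∈ moved M I O y ↔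
      ∃ c, Sum.inl c ∈ O y ∧ e ∈ con c ((total M \ total I) ∪ total O) := by
  constructor
  · rintro ⟨c, x, h1, -, h3⟩
    refine ⟨c, h1, con_mono ?_ _ h3⟩
    exact Set.union_subset_union_left _ (Set.sdiff_subset_sdiff_left fun e he => ⟨x, he⟩)
  · have tokCase : ∀ {c b}, Sum.inl c ∈ O y → Conn ((total M \ total I) ∪ total O) c b →
        Sum.inl b ∈ (total M \ total I) ∪ total O → ∃ c x, Sum.inl c ∈ O y ∧ Sum.inl c ∈ M x ∧
          Conn ((M x \ total I) ∪ total O) c b ∧ Sum.inl b ∈ M x := by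
      intro c b hc hb hb'
      obtain ⟨c', x, h1, h2, h3⟩ := h.local_of_conn hc hb
      by_cases hbO : Sum.inl b ∈ total O
      · obtain ⟨y', hy'⟩ := hbO
        cases h.out_eq_of_conn hc hy' hb
        obtain ⟨x, hx⟩ := (h.tok b).2 ⟨y, hy'⟩
        exact ⟨b, x, hy', h.in_sub x hx, .refl, h.in_sub x hx⟩
      · refine ⟨c', x, h1, h2, h3, ?_⟩
        rcases h3.cases_tail with rfl | ⟨e, -, he⟩
        · exact h2
        · rcases he.2 with he | he
          · exact he.1
          · exact absurd he hbO
    rintro ⟨c, hc, h2⟩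
    rcases e with b | ⟨b, d⟩
    · obtain ⟨h3, h4⟩ := inl_mem_con.1 h2
      obtain ⟨c, x, h5, h6, h7, h8⟩ := tokCase hc h4 h3
      exact ⟨c, x, h5, h6, inl_mem_con.2 ⟨h.tok_mem_replace h8, h7⟩⟩
    · obtain ⟨h3, h4⟩ := (inr_mem_con h.total_proper_closed).1 h2
      obtain ⟨c, x, h5, h6, h7, h8⟩ := tokCase hc h4 (h.total_proper_closed _ _ h3)
      refine ⟨c, x, h5, h6, (inr_mem_con (h.closed_replace (h.proper.closed x))).2 ⟨?_, h7⟩⟩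
      rcases h3 with ⟨⟨x', hx'⟩, hI⟩ | h3
      · cases h.proper.unique b x x' h8 (h.proper.closed x' _ _ hx')
        exact Or.inl ⟨hx', hI⟩
      · exact Or.inr h3

theorem in_sub_taken (x : P) : I x ⊆ taken M I x := by
  rintro (a | ⟨a, b⟩) ha
  · exact ⟨a, ha, inl_mem_con.2 ⟨h.in_sub x ha, .refl⟩⟩
  · exact ⟨a, h.in_closed x _ _ ha, (inr_mem_con (h.proper.closed x)).2 ⟨h.in_sub x ha, .refl⟩⟩

omit h in
theorem taken_sub (M I : P → Set (Item X)) (x : P) : taken M I x ⊆ M x :=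
  fun _ ⟨_, _, h⟩ => con_subset h

theorem inr_mem_taken {x : P} {a b : X} :
    Sum.inr s(a, b) ∈ taken M I x ↔ Sum.inr s(a, b) ∈ M x ∧ Sum.inl a ∈ taken M I x := by
  constructor
  · rintro ⟨c, h1, h2⟩
    obtain ⟨h3, h4⟩ := (inr_mem_con (h.proper.closed x)).1 h2
    exact ⟨h3, c, h1, inl_mem_con.2 ⟨h.proper.closed x _ _ h3, h4⟩⟩
  · rintro ⟨h1, c, h2, h3⟩
    exact ⟨c, h2, (inr_mem_con (h.proper.closed x)).2 ⟨h1, (inl_mem_con.1 h3).2⟩⟩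

theorem taken_closed (x : P) : Closed (taken M I x) := fun _ _ hb => (h.inr_mem_taken.1 hb).2

theorem proper_taken : Proper (taken M I) where
  closed := h.taken_closed
  unique a x y h1 h2 := h.proper.unique a x y (taken_sub M I x h1) (taken_sub M I y h2)

theorem proper_rest : Proper fun x => M x \ taken M I x where
  closed x a b := by
    rintro ⟨h1, h2⟩
    exact ⟨h.proper.closed x _ _ h1, fun h3 => h2 (h.inr_mem_taken.2 ⟨h1, h3⟩)⟩
  unique a x y h1 h2 := h.proper.unique a x y h1.1 h2.1

/-- Follow the path in `M x` from a selected token. A bond of `I` on it may be gone after the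
replacement, but its far end is again selected, so the path restarts there. -/
theorem conn_of_taken {a : X} {x : P} (ha : Sum.inl a ∈ taken M I x) :
    ∃ c y, Sum.inl c ∈ O y ∧ Conn ((total M \ total I) ∪ total O) c a := by
  obtain ⟨c, h1, h2⟩ := ha
  have start : ∀ c, Sum.inl c ∈ I x →
      ∃ c' y, Sum.inl c' ∈ O y ∧ Conn ((total M \ total I) ∪ total O) c' c := by
    intro c hc
    obtain ⟨y, hy⟩ := (h.tok c).1 ⟨x, hc⟩
    exact ⟨c, y, hy, .refl⟩
  have h3 := (inl_mem_con.1 h2).2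
  clear h2
  induction h3 with
  | refl => exact start c h1
  | @tail b d _ hl ih =>
    by_cases hI : Sum.inr s(b, d) ∈ total I
    · exact start d (h.mem_of_in ((total_closed h.in_closed).right hI) hl.2)
    · obtain ⟨c', y, h3, h4⟩ := ih
      exact ⟨c', y, h3, h4.tail ⟨Or.inl ⟨⟨x, hl.1⟩, hI⟩, h.tok_mem_replace ⟨x, hl.2⟩⟩⟩

/-- Old bonds stay within a component of `M`, and the ends of new bonds are selected tokens, which
are taken anyway. -/
theorem taken_of_conn {c a : X} {y : P} (hc : Sum.inl c ∈ O y)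
    (ha : Conn ((total M \ total I) ∪ total O) c a) : Sum.inl a ∈ total (taken M I) := by
  induction ha with
  | refl =>
    obtain ⟨x, hx⟩ := (h.tok c).2 ⟨y, hc⟩
    exact ⟨x, h.in_sub_taken x hx⟩
  | @tail b d _ hl ih =>
    rcases hl.1 with ⟨⟨x', hx'⟩, hI⟩ | hO
    · obtain ⟨x, hx⟩ := ih
      cases h.proper.unique b x x' (taken_sub M I x hx) (h.proper.closed x' _ _ hx')
      obtain ⟨c', h1, h2⟩ := hx
      have hd := (h.proper.closed _).right hx'
      exact ⟨_, c', h1, inl_mem_con.2 ⟨hd, (inl_mem_con.1 h2).2.tail ⟨hx', hd⟩⟩⟩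
    · obtain ⟨x, hx⟩ := (h.tok d).2 ((total_closed h.out_closed).right hO)
      exact ⟨x, h.in_sub_taken x hx⟩

theorem inl_mem_total_moved {a : X} :
    Sum.inl a ∈ total (moved M I O) ↔ Sum.inl a ∈ total (taken M I) := by
  constructor
  · rintro ⟨y, hy⟩
    obtain ⟨c, hc, h1⟩ := h.mem_moved.1 hy
    exact h.taken_of_conn hc (inl_mem_con.1 h1).2
  · rintro ⟨x, hx⟩
    obtain ⟨c, y, h1, h2⟩ := h.conn_of_taken hx
    exact ⟨y, h.mem_moved.2 ⟨c, h1,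
      inl_mem_con.2 ⟨h.tok_mem_replace ⟨x, taken_sub M I x hx⟩, h2⟩⟩⟩

theorem inr_mem_moved {y : P} {a b : X} :
    Sum.inr s(a, b) ∈ moved M I O y ↔
      Sum.inr s(a, b) ∈ (total M \ total I) ∪ total O ∧ Sum.inl a ∈ moved M I O y := by
  constructor
  · intro h1
    obtain ⟨c, hc, h2⟩ := h.mem_moved.1 h1
    obtain ⟨h3, h4⟩ := (inr_mem_con h.total_proper_closed).1 h2
    exact ⟨h3, h.mem_moved.2 ⟨c, hc, inl_mem_con.2 ⟨h.total_proper_closed _ _ h3, h4⟩⟩⟩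
  · rintro ⟨h1, h2⟩
    obtain ⟨c, hc, h2⟩ := h.mem_moved.1 h2
    exact h.mem_moved.2 ⟨c, hc,
      (inr_mem_con h.total_proper_closed).2 ⟨h1, (inl_mem_con.1 h2).2⟩⟩

theorem proper_moved : Proper (moved M I O) where
  closed x a b hb := (h.inr_mem_moved.1 hb).2
  unique a x y h1 h2 := by
    obtain ⟨c, hc, h1⟩ := h.mem_moved.1 h1
    obtain ⟨d, hd, h2⟩ := h.mem_moved.1 h2
    exact h.out_eq_of_conn hc hd ((inl_mem_con.1 h1).2.trans
      (Conn.symm h.total_proper_closed (inl_mem_con.1 h2).2))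

theorem out_sub_moved (y : P) : O y ⊆ moved M I O y := by
  have tokCase : ∀ a, Sum.inl a ∈ O y → Sum.inl a ∈ moved M I O y := fun a ha =>
    h.mem_moved.2 ⟨a, ha, inl_mem_con.2 ⟨Or.inr ⟨y, ha⟩, .refl⟩⟩
  rintro (a | ⟨a, b⟩) ha
  · exact tokCase a ha
  · exact h.inr_mem_moved.2 ⟨Or.inr ⟨y, ha⟩, tokCase a (h.out_closed y _ _ ha)⟩

/-- This is where `noRec` enters reversibility: a bond of `O` already present in `M` must be
required by `I`, so deleting `O` on the way back loses nothing that `I` does not restore. -/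
theorem bond_in_of_out {a b : X} (h1 : Sum.inr s(a, b) ∈ total M)
    (ha : Sum.inl a ∈ total I) (hb : Sum.inl b ∈ total I) : Sum.inr s(a, b) ∈ total I := by
  obtain ⟨x, hx⟩ := h1
  exact ⟨x, h.noRec x a b (h.mem_of_in ha (h.proper.closed x _ _ hx))
    (h.mem_of_in hb ((h.proper.closed x).right hx)) hx⟩

/-- Replacing back restores the items taken. -/
theorem total_moved_replace :
    (total (moved M I O) \ total O) ∪ total I = total (taken M I) := by
  have hI : total I ⊆ total (taken M I) := fun e ⟨x, hx⟩ => ⟨x, h.in_sub_taken x hx⟩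
  apply item_ext
  · intro a
    constructor
    · rintro (⟨h1, -⟩ | h1)
      · exact h.inl_mem_total_moved.1 h1
      · exact hI h1
    · intro h1
      by_cases h2 : Sum.inl a ∈ total I
      · exact Or.inr h2
      · exact Or.inl ⟨h.inl_mem_total_moved.2 h1, fun h3 => h2 ((h.tok a).2 h3)⟩
  · intro a b
    constructor
    · rintro (⟨⟨y, h1⟩, h2⟩ | h1)
      · obtain ⟨h3, h4⟩ := h.inr_mem_moved.1 h1
        rcases h3 with ⟨⟨x, hx⟩, -⟩ | h3
        · obtain ⟨x', hx'⟩ := h.inl_mem_total_moved.1 ⟨y, h4⟩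
          cases h.proper.unique a x x' (h.proper.closed x _ _ hx) (taken_sub M I x' hx')
          exact ⟨x, h.inr_mem_taken.2 ⟨hx, hx'⟩⟩
        · exact absurd h3 h2
      · exact hI h1
    · rintro ⟨x, h1⟩
      obtain ⟨h2, h3⟩ := h.inr_mem_taken.1 h1
      by_cases h4 : Sum.inr s(a, b) ∈ total I
      · exact Or.inr h4
      · obtain ⟨y, hy⟩ := h.inl_mem_total_moved.2 ⟨x, h3⟩
        refine Or.inl ⟨⟨y, h.inr_mem_moved.2 ⟨Or.inl ⟨⟨x, h2⟩, h4⟩, hy⟩⟩, fun h5 => h4 ?_⟩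
        exact h.bond_in_of_out ⟨x, h2⟩ ((h.tok a).2 (total_closed h.out_closed _ _ h5))
          ((h.tok b).2 ((total_closed h.out_closed).right h5))

theorem mem_of_conn_total {a b : X} {x : P} (ha : Sum.inl a ∈ M x) (hb : Conn (total M) a b) :
    Sum.inl b ∈ M x := by
  induction hb with
  | refl => exact ha
  | tail _ hl ih =>
    obtain ⟨x', hx'⟩ := hl.1
    cases h.proper.unique _ x x' ih (h.proper.closed x' _ _ hx')
    exact (h.proper.closed x).right hx'

/-- The reverse of a move is a move. -/
theorem reverse : Move (moved M I O) O I where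
  proper := h.proper_moved
  in_closed := h.out_closed
  out_closed := h.in_closed
  in_sub := h.out_sub_moved
  tok a := (h.tok a).symm
  out_unique a x y h1 h2 := h.proper.unique a x y (h.in_sub x h1) (h.in_sub y h2)
  noRec y a b ha hb h1 := by
    rcases (h.inr_mem_moved.1 h1).1 with ⟨h2, h3⟩ | ⟨y', hy'⟩
    · exact absurd (h.bond_in_of_out h2 ((h.tok a).2 ⟨y, ha⟩) ((h.tok b).2 ⟨y, hb⟩)) h3
    · cases h.out_unique a y y' ha (h.out_closed y' _ _ hy')
      exact hy'
  noClone a b x₁ x₂ hne ha hb y _ h1 := by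
    -- Replacing back only produces items of the original marking, and there connected tokens share
    -- a place; so tokens returning to different places cannot be connected.
    have hsub : (moved M I O y \ total O) ∪ total I ⊆ total M := by
      refine subset_trans ?_ (subset_trans h.total_moved_replace.subset
        fun e ⟨x, hx⟩ => ⟨x, taken_sub M I x hx⟩)
      exact Set.union_subset_union_left _ (Set.sdiff_subset_sdiff_left fun e he => ⟨y, he⟩)
    have h2 := h.mem_of_conn_total (h.in_sub x₂ hb) (Conn.mono hsub (inl_mem_con.1 h1).2)
    exact hne (h.proper.unique a x₁ x₂ (h.in_sub x₁ ha) h2)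

/-- Every moved component contains a token of `O`, so the reverse move leaves nothing behind. -/
theorem taken_reverse (y : P) : taken (moved M I O) O y = moved M I O y := by
  refine Set.Subset.antisymm (taken_sub _ _ _) fun e he => ?_
  obtain ⟨c, hc, h1⟩ := h.mem_moved.1 he
  refine ⟨c, hc, ?_⟩
  have hsub : con c ((total M \ total I) ∪ total O) ⊆ moved M I O y :=
    fun e he => h.mem_moved.2 ⟨c, hc, he⟩
  rcases e with b | ⟨b, d⟩
  · exact inl_mem_con.2 ⟨he, Conn.mono hsub (Conn.of_con (inl_mem_con.1 h1).2)⟩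
  · exact (inr_mem_con (h.proper_moved.closed y)).2
      ⟨he, Conn.mono hsub (Conn.of_con ((inr_mem_con h.total_proper_closed).1 h1).2)⟩

theorem moved_reverse (x : P) : moved (moved M I O) O I x = taken M I x := by
  -- Replacing back yields all items taken, from all places together; a component started in `x`
  -- stays in `x`.
  have key : ∀ c, Sum.inl c ∈ I x → con c (total (taken M I)) = con c (M x) := by
    intro c hc
    refine con_congr {a | Sum.inl a ∈ taken M I x} (h.in_sub_taken x hc) ?_ ?_ ?_
    · exact fun b hb => ⟨fun _ => taken_sub M I x hb, fun _ => ⟨x, hb⟩⟩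
    · refine fun b hb d => ⟨?_, fun h1 => ⟨x, h.inr_mem_taken.2 ⟨h1, hb⟩⟩⟩
      rintro ⟨x', hx'⟩
      cases h.proper_taken.unique b x x' hb (h.taken_closed x' _ _ hx')
      exact taken_sub M I x hx'
    · rintro b hb d ⟨x', hx'⟩
      cases h.proper_taken.unique b x x' hb (h.taken_closed x' _ _ hx')
      exact (h.taken_closed x).right hx'
  ext e
  rw [h.reverse.mem_moved, h.total_moved_replace]
  constructor
  · rintro ⟨c, hc, he⟩
    exact ⟨c, hc, key c hc ▸ he⟩
  · rintro ⟨c, hc, he⟩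
    exact ⟨c, hc, (key c hc).symm ▸ he⟩

end Move

/-! ### Frame property: separate parts of a marking do not interact -/

/-- Markings without common tokens. -/
def Apart (M M' : P → Set (Item X)) : Prop := ∀ a x y, Sum.inl a ∈ M x → Sum.inl a ∉ M' y

theorem Proper.union {M M' : P → Set (Item X)} (h : Proper M) (h' : Proper M') (ha : Apart M M') :
    Proper fun x => M x ∪ M' x where
  closed x a b := Or.imp (h.closed x a b) (h'.closed x a b)
  unique a x y := by
    rintro (h1 | h1) (h2 | h2)
    · exact h.unique a x y h1 h2
    · exact absurd h2 (ha a _ _ h1)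
    · exact absurd h1 (ha a _ _ h2)
    · exact h'.unique a x y h1 h2

section Frame
variable {M M' I O : P → Set (Item X)} (hM' : Proper M') (ha : Apart M M')
include hM' ha

theorem con_union_apart (hM : Proper M) {c : X} {x : P} (hc : Sum.inl c ∈ M x) :
    con c (M x ∪ M' x) = con c (M x) := by
  refine con_congr {a | Sum.inl a ∈ M x} hc ?_ ?_ ?_
  · exact fun b hb => ⟨fun _ => hb, fun _ => Or.inl hb⟩
  · exact fun b hb d => ⟨fun h => h.resolve_right fun h' => ha b x x hb (hM'.closed x _ _ h'), Or.inl⟩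
  · exact fun b hb d h =>
      (hM.closed x).right (h.resolve_right fun h' => ha b x x hb (hM'.closed x _ _ h'))

/-- New bonds join only tokens of `M`, and `M'` has no bond touching such a token, so a path
starting in `M` never enters `M'`. -/
theorem con_replace_union_apart (hM : Proper M) (hO : ∀ x, Closed (O x))
    (hOM : ∀ a, Sum.inl a ∈ total O → Sum.inl a ∈ total M) {c : X} (hc : Sum.inl c ∈ total M)
    (x : P) :
    con c (((M x ∪ M' x) \ total I) ∪ total O) = con c ((M x \ total I) ∪ total O) := by
  have key : ∀ b ∈ {a | Sum.inl a ∈ total M}, ∀ d, Sum.inr s(b, d) ∈ M x ∪ M' x →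
      Sum.inr s(b, d) ∈ M x := fun b ⟨y, hb⟩ d h =>
    h.resolve_right fun h' => ha b y x hb (hM'.closed x _ _ h')
  refine con_congr {a | Sum.inl a ∈ total M} hc ?_ ?_ ?_
  · rintro b ⟨y, hb⟩
    constructor
    · rintro (⟨h1 | h1, h2⟩ | h1)
      · exact Or.inl ⟨h1, h2⟩
      · exact absurd h1 (ha b y x hb)
      · exact Or.inr h1
    · rintro (⟨h1, h2⟩ | h1)
      · exact Or.inl ⟨Or.inl h1, h2⟩
      · exact Or.inr h1
  · intro b hb d
    constructor
    · rintro (⟨h1, h2⟩ | h1)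
      · exact Or.inl ⟨key b hb d h1, h2⟩
      · exact Or.inr h1
    · rintro (⟨h1, h2⟩ | h1)
      · exact Or.inl ⟨Or.inl h1, h2⟩
      · exact Or.inr h1
  · rintro b hb d (⟨h1, h2⟩ | h1)
    · exact ⟨x, (hM.closed x).right (key b hb d h1)⟩
    · exact hOM _ ((total_closed hO).right h1)

theorem Move.union (h : Move M I O) : Move (fun x => M x ∪ M' x) I O where
  proper := h.proper.union hM' ha
  in_closed := h.in_closed
  out_closed := h.out_closed
  in_sub x := (h.in_sub x).trans Set.subset_union_left
  tok := h.tok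
  out_unique := h.out_unique
  noRec x a b h1 h2 h3 := h.noRec x a b h1 h2
    (h3.resolve_right fun h' => ha a x x (h.in_sub x h1) (hM'.closed x _ _ h'))
  noClone a b y₁ y₂ hne h1 h2 x hx := by
    have hOM : ∀ a, Sum.inl a ∈ total O → Sum.inl a ∈ total M := fun a h1 =>
      let ⟨x, hx⟩ := (h.tok a).2 h1
      ⟨x, h.in_sub x hx⟩
    rw [con_replace_union_apart hM' ha h.proper h.out_closed hOM (hOM b ⟨y₂, h2⟩)]
    exact h.noClone a b y₁ y₂ hne h1 h2 x hx

/-- Together with `Move.union`, this transports a move from one context to another, which is how a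
step is exchanged with an independent one. -/
theorem Move.of_union (hM : Proper M) (hI : ∀ x, I x ⊆ M x)
    (h : Move (fun x => M x ∪ M' x) I O) : Move M I O where
  proper := hM
  in_closed := h.in_closed
  out_closed := h.out_closed
  in_sub := hI
  tok := h.tok
  out_unique := h.out_unique
  noRec x a b h1 h2 h3 := h.noRec x a b h1 h2 (Or.inl h3)
  noClone a b y₁ y₂ hne h1 h2 x hx := by
    have hOM : ∀ a, Sum.inl a ∈ total O → Sum.inl a ∈ total M := fun a h1 =>
      let ⟨x, hx⟩ := (h.tok a).2 h1
      ⟨x, hI x hx⟩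
    rw [← con_replace_union_apart hM' ha hM h.out_closed hOM (hOM b ⟨y₂, h2⟩)]
    exact h.noClone a b y₁ y₂ hne h1 h2 x hx

theorem taken_union (h : Move M I O) (x : P) : taken (fun x => M x ∪ M' x) I x = taken M I x := by
  ext e
  refine exists_congr fun c => and_congr_right fun hc => ?_
  rw [con_union_apart hM' ha h.proper (h.in_sub x hc)]

theorem moved_union (h : Move M I O) (y : P) :
    moved (fun x => M x ∪ M' x) I O y = moved M I O y := by
  have hOM : ∀ a, Sum.inl a ∈ total O → Sum.inl a ∈ total M := fun a h1 =>
    let ⟨x, hx⟩ := (h.tok a).2 h1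
    ⟨x, h.in_sub x hx⟩
  ext e
  refine exists_congr fun c => exists_congr fun x => and_congr_right fun hc => ?_
  rw [con_replace_union_apart hM' ha h.proper h.out_closed hOM (hOM c ⟨y, hc⟩)]
  refine and_congr_left fun _ => ⟨?_, Or.inl⟩
  rintro (h1 | h1)
  · exact h1
  · obtain ⟨x', hx'⟩ := hOM c ⟨y, hc⟩
    exact absurd h1 (ha c x' x hx')

end Frame

theorem union_diff_of_apart {M M' : P → Set (Item X)} (hM : Proper M) (hM' : Proper M')
    (ha : Apart M M') (x : P) : (M x ∪ M' x) \ M x = M' x := by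
  rw [Set.union_sdiff_left, sdiff_eq_left, Set.disjoint_left]
  rintro (a | ⟨a, b⟩) h1 h2
  · exact ha a x x h2 h1
  · exact ha a x x (hM.closed x _ _ h2) (hM'.closed x _ _ h1)

end Components
end MultiRPN
namespace MultiRPN

/-! ### Keys in memories and their renaming -/

namespace Tok
variable {A V : Type*}

/-- The keys in the memory of an instance. -/
def keys : Tok A V → Set ℕ
  | base _ _ => ∅
  | mem b k _ => insert k b.keys

/-- Later memories have larger keys. -/
def Mono : Tok A V → Prop
  | base _ _ => True
  | mem b k _ => b.Mono ∧ ∀ k' ∈ b.keys, k' < k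

theorem EvolvedTo.mem_keys {b a : Tok A V} {k : ℕ} {u : Option V}
    (h : EvolvedTo (Tok.mem b k u) a) :
    k ∈ a.keys := by
  induction h with
  | refl => exact Or.inl rfl
  | mem _ _ _ ih => exact Or.inr ih

theorem exists_evolvedTo {a : Tok A V} {k : ℕ} (h : k ∈ a.keys) :
    ∃ b u, EvolvedTo (mem b k u) a := by
  induction a with
  | base => exact absurd h (Set.notMem_empty _)
  | mem b k' u ih =>
    rcases h with rfl | h
    · exact ⟨b, u, .refl⟩
    · obtain ⟨c, v, h'⟩ := ih h
      exact ⟨c, v, h'.mem _ _⟩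

theorem rekey_injective {φ : ℕ → ℕ} (hφ : φ.Injective) :
    (rekey φ : Tok A V → Tok A V).Injective := by
  intro a
  induction a with
  | base a i => rintro (_ | _) h <;> cases h; rfl
  | mem b k u ih =>
    rintro (_ | ⟨c, l, v⟩) h
    · cases h
    · obtain ⟨h1, h2, rfl⟩ := mem.inj h
      rw [ih h1, hφ h2]

theorem keys_rekey (φ : ℕ → ℕ) (a : Tok A V) : (a.rekey φ).keys = φ '' a.keys := by
  induction a with
  | base => exact (Set.image_empty _).symm
  | mem b k u ih => simp only [rekey, keys, ih, Set.image_insert_eq]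

theorem rekey_rekey (φ ψ : ℕ → ℕ) (a : Tok A V) :
    (a.rekey φ).rekey ψ = a.rekey fun k => ψ (φ k) := by
  induction a with
  | base => rfl
  | mem b k u ih => simp only [rekey, ih]

theorem origin_rekey (φ : ℕ → ℕ) (a : Tok A V) : (a.rekey φ).origin = a.origin := by
  induction a with
  | base => rfl
  | mem b k u ih => exact ih

theorem ty_rekey (φ : ℕ → ℕ) (a : Tok A V) : (a.rekey φ).ty = a.ty := by
  induction a with
  | base => rfl
  | mem b k u ih => exact ih

theorem rekey_congr {φ ψ : ℕ → ℕ} {a : Tok A V} (h : ∀ k ∈ a.keys, φ k = ψ k) :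
    a.rekey φ = a.rekey ψ := by
  induction a with
  | base => rfl
  | mem b k u ih =>
    simp only [rekey, h k (Or.inl rfl), ih fun k hk => h k (Or.inr hk)]

theorem rekey_id (a : Tok A V) : a.rekey (fun k => k) = a := by
  induction a with
  | base => rfl
  | mem b k u ih => simp only [rekey, ih]

/-- In both tokens the order of keys is the nesting order of memories, which renaming does not
change. -/
theorem Mono.lt_of_lt {a : Tok A V} {φ : ℕ → ℕ} (ha : a.Mono) (hφ : (a.rekey φ).Mono) {k l : ℕ}
    (hk : k ∈ a.keys) (hl : l ∈ a.keys) (hkl : k < l) : φ k < φ l := by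
  induction a with
  | base => exact absurd hk (Set.notMem_empty _)
  | mem b m u ih =>
    rcases hl with rfl | hl
    · rcases hk with rfl | hk
      · exact absurd hkl (lt_irrefl _)
      · exact hφ.2 _ (by rw [keys_rekey]; exact ⟨k, hk, rfl⟩)
    · rcases hk with rfl | hk
      · exact absurd (ha.2 _ hl) hkl.asymm
      · exact ih ha.1 hφ.1 hk hl

end Tok

namespace State
variable {P T A V : Type*}

/-- Rename the keys of a state. -/
def rekey (φ : Equiv.Perm ℕ) (S : State P T A V) : State P T A V where
  M x := Item.map (Tok.rekey φ) '' S.M x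
  H t := φ '' S.H t

theorem rekey_rekey (φ ψ : Equiv.Perm ℕ) (S : State P T A V) :
    (S.rekey φ).rekey ψ = S.rekey (φ.trans ψ) := by
  ext x e
  · simp only [rekey, Set.mem_image, exists_exists_and_eq_and, Item.map_comp, Tok.rekey_rekey]
    rfl
  · simp only [rekey, Set.mem_image, exists_exists_and_eq_and]
    rfl

theorem rekey_refl (S : State P T A V) : S.rekey (Equiv.refl ℕ) = S := by
  have h : (Item.map (Tok.rekey fun k => k) : Item (Tok A V) → Item (Tok A V)) = id := by
    funext e
    rcases e with a | ⟨a, b⟩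
    · exact congrArg Sum.inl (Tok.rekey_id a)
    · exact congrArg₂ (fun a b => Sum.inr s(a, b)) (Tok.rekey_id a) (Tok.rekey_id b)
  ext x e
  · show e ∈ Item.map (Tok.rekey fun k => k) '' S.M x ↔ _
    rw [h, Set.image_id]
  · show e ∈ (fun k => k) '' S.H x ↔ _
    rw [Set.image_id']

end State

theorem Item.map_image_congr {X Y : Type*} {f g : X → Y} {C : Set (Item X)} (hC : Closed C)
    (h : ∀ a, Sum.inl a ∈ C → f a = g a) : Item.map f '' C = Item.map g '' C := by
  refine Set.image_congr ?_
  rintro (a | ⟨a, b⟩) he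
  · exact congrArg Sum.inl (h a he)
  · exact congrArg₂ (fun a b => Sum.inr s(a, b)) (h a (hC _ _ he)) (h b (hC.right he))

theorem exists_token_of_mem {X : Type*} {C : Set (Item X)} (hC : Closed C) {e : Item X}
    (he : e ∈ C) : ∃ a, Sum.inl a ∈ C ∧ ∀ D : Set (Item X), Closed D → e ∈ D → Sum.inl a ∈ D := by
  rcases e with a | ⟨a, b⟩
  · exact ⟨a, he, fun _ _ h => h⟩
  · exact ⟨a, hC _ _ he, fun _ hD h => hD _ _ h⟩

namespace State
variable {P T A V : Type*}

/-- Only the values on memory keys and the images of the history sets matter. This freedom is used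
to correct a permutation so that it matches the keys of a given step. -/
theorem rekey_congr {S : State P T A V} {φ ψ : Equiv.Perm ℕ} (hS : Proper S.M)
    (hk : ∀ a x, Sum.inl a ∈ S.M x → ∀ k ∈ a.keys, φ k = ψ k)
    (hH : ∀ t, φ '' S.H t = ψ '' S.H t) : S.rekey φ = S.rekey ψ := by
  have hM : (S.rekey φ).M = (S.rekey ψ).M := by
    funext x
    exact Item.map_image_congr (hS.closed x) fun a ha => Tok.rekey_congr (hk a x ha)
  have hH' : (S.rekey φ).H = (S.rekey ψ).H := funext hH
  cases h : S.rekey φ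
  cases h' : S.rekey ψ
  simp_all

end State

/-! ### Steps of the net expressed as moves -/

namespace MRPN
variable {P T A V : Type*} (N : MRPN P T A V)

theorem markEquiv_iff {S S' : State P T A V} : MarkEquiv S S' ↔ ∃ φ, S' = S.rekey φ := by
  refine exists_congr fun φ => ⟨fun ⟨h1, h2⟩ => ?_, ?_⟩
  · ext x e
    · rw [h2]; rfl
    · show e ∈ S'.H x ↔ e ∈ φ '' S.H x
      rw [Equiv.image_eq_preimage_symm, Set.mem_preimage, h1, Equiv.apply_symm_apply]
  · rintro rfl
    exact ⟨fun t k => (φ.injective.mem_set_image).symm, fun x => rfl⟩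

/-- The items required on the incoming arcs of `t`, by places. -/
def inItems (t : T) (U : V → Tok A V) (x : P) : Set (Item (Tok A V)) := Item.map U '' N.inArc x t

/-- The items on the outgoing arcs of `t`, by places. -/
def outItems (t : T) (U : V → Tok A V) (x : P) : Set (Item (Tok A V)) := Item.map U '' N.outArc t x

theorem preItems_eq (t : T) (U : V → Tok A V) : N.preItems t U = total (N.inItems t U) := by
  ext e
  simp only [preItems, total, inItems, Set.mem_image, Set.mem_ofPred_eq, eq_comm]

theorem postItems_eq (t : T) (U : V → Tok A V) : N.postItems t U = total (N.outItems t U) := by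
  ext e
  simp only [postItems, total, outItems, Set.mem_image, Set.mem_ofPred_eq, eq_comm]

theorem inl_mem_inItems {t : T} {U : V → Tok A V} {x : P} {a : Tok A V} :
    Sum.inl a ∈ N.inItems t U x ↔ ∃ u, a = U u ∧ Sum.inl u ∈ N.inArc x t := Item.inl_mem_image

theorem inl_mem_outItems {t : T} {U : V → Tok A V} {x : P} {a : Tok A V} :
    Sum.inl a ∈ N.outItems t U x ↔ ∃ u, a = U u ∧ Sum.inl u ∈ N.outArc t x := Item.inl_mem_image

theorem fwdIn_eq (S : State P T A V) (t : T) (U : V → Tok A V) (x : P) :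
    N.fwdIn S t U x = taken S.M (N.inItems t U) x := by
  ext e
  simp only [fwdIn, taken, inl_mem_inItems, Set.mem_ofPred_eq]
  constructor
  · rintro ⟨u, h1, h2⟩; exact ⟨U u, ⟨u, rfl, h1⟩, h2⟩
  · rintro ⟨_, ⟨u, rfl, h1⟩, h2⟩; exact ⟨u, h1, h2⟩

theorem revIn_eq (S : State P T A V) (t : T) (U : V → Tok A V) (x : P) :
    N.revIn S t U x = taken S.M (N.outItems t U) x := by
  ext e
  simp only [revIn, taken, inl_mem_outItems, Set.mem_ofPred_eq]
  constructor
  · rintro ⟨u, h1, h2⟩; exact ⟨U u, ⟨u, rfl, h1⟩, h2⟩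
  · rintro ⟨_, ⟨u, rfl, h1⟩, h2⟩; exact ⟨u, h1, h2⟩

theorem fwdOut_eq (S : State P T A V) (t : T) (U : V → Tok A V) (x : P) :
    N.fwdOut S t U x = moved S.M (N.inItems t U) (N.outItems t U) x := by
  ext e
  simp only [fwdOut, moved, inl_mem_outItems, Set.mem_ofPred_eq, preItems_eq, postItems_eq]
  constructor
  · rintro ⟨u, y, h1, h2⟩; exact ⟨U u, y, ⟨u, rfl, h1⟩, h2⟩
  · rintro ⟨_, y, ⟨u, rfl, h1⟩, h2⟩; exact ⟨u, y, h1, h2⟩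

theorem revOut_eq (S : State P T A V) (t : T) (U : V → Tok A V) (x : P) :
    N.revOut S t U x = moved S.M (N.outItems t U) (N.inItems t U) x := by
  ext e
  simp only [revOut, moved, inl_mem_inItems, Set.mem_ofPred_eq, preItems_eq, postItems_eq]
  constructor
  · rintro ⟨u, y, h1, h2⟩; exact ⟨U u, y, ⟨u, rfl, h1⟩, h2⟩
  · rintro ⟨_, y, ⟨u, rfl, h1⟩, h2⟩; exact ⟨u, y, h1, h2⟩

theorem inArc_closed (x : P) (t : T) : Closed (N.inArc x t) :=
  fun u v h => (N.inArc_bond x t u v h).1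

theorem outArc_closed (t : T) (x : P) : Closed (N.outArc t x) :=
  fun u v h => (N.outArc_bond t x u v h).1

variable {N}

/-- Well-formedness supplies the conditions on `O`: the same tokens occur on both sides, each with
one destination. Injectivity of `U` translates between conditions on variables and conditions on
tokens. -/
theorem fwdEnabled_iff (hN : N.WellFormed) {S : State P T A V} (hS : Proper S.M) {t : T}
    {U : V → Tok A V} : N.FwdEnabled S t U ↔ Set.InjOn U (N.guardVars t) ∧
      (∀ u ∈ N.guardVars t, N.varTy u = (U u).ty) ∧
      Move S.M (N.inItems t U) (N.outItems t U) := by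
  constructor
  · intro h
    refine ⟨h.inj, fun u ⟨x, hx⟩ => (h.tokens x u hx).2, ?_⟩
    refine
      { proper := hS
        in_closed := fun x => (N.inArc_closed x t).image U
        out_closed := fun x => (N.outArc_closed t x).image U
        in_sub := ?_, tok := ?_, out_unique := ?_, noRec := ?_, noClone := ?_ }
    · rintro x _ ⟨u | ⟨u, v⟩, hl, rfl⟩
      · exact (h.tokens x u hl).1
      · exact h.bonds x u v hl
    · intro a
      constructor
      · rintro ⟨x, hx⟩
        obtain ⟨u, rfl, hu⟩ := N.inl_mem_inItems.1 hx
        obtain ⟨y, hy⟩ : u ∈ N.effectVars t := (hN t).1 ▸ ⟨x, hu⟩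
        exact ⟨y, N.inl_mem_outItems.2 ⟨u, rfl, hy⟩⟩
      · rintro ⟨x, hx⟩
        obtain ⟨u, rfl, hu⟩ := N.inl_mem_outItems.1 hx
        obtain ⟨y, hy⟩ : u ∈ N.guardVars t := (hN t).1 ▸ ⟨x, hu⟩
        exact ⟨y, N.inl_mem_inItems.2 ⟨u, rfl, hy⟩⟩
    · intro a x y hx hy
      obtain ⟨u, rfl, hu⟩ := N.inl_mem_outItems.1 hx
      obtain ⟨v, e, hv⟩ := N.inl_mem_outItems.1 hy
      have hu' : u ∈ N.guardVars t := (hN t).1 ▸ ⟨x, hu⟩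
      have hv' : v ∈ N.guardVars t := (hN t).1 ▸ ⟨y, hv⟩
      cases h.inj hu' hv' e
      by_contra hne
      exact (hN t).2 x y u hne ⟨hu, hv⟩
    · intro x a b ha hb hab
      obtain ⟨u, rfl, hu⟩ := N.inl_mem_inItems.1 ha
      obtain ⟨v, rfl, hv⟩ := N.inl_mem_inItems.1 hb
      exact ⟨_, h.noRecreate x u v hu hv hab, rfl⟩
    · intro a b y₁ y₂ hne ha hb x hx
      obtain ⟨u, rfl, hu⟩ := N.inl_mem_outItems.1 ha
      obtain ⟨v, rfl, hv⟩ := N.inl_mem_outItems.1 hb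
      rw [← preItems_eq, ← postItems_eq]
      exact h.noClone u v y₁ y₂ hne hu hv x hx.of_image
  · rintro ⟨hinj, hty, h⟩
    refine ⟨hinj, ?_, ?_, ?_, ?_⟩
    · exact fun x u hu => ⟨h.in_sub x ⟨_, hu, rfl⟩, hty u ⟨x, hu⟩⟩
    · exact fun x u v huv => h.in_sub x ⟨_, huv, rfl⟩
    · intro x u v hu hv huv
      obtain ⟨u', v', e1, e2, h1⟩ :=
        Item.inr_mem_image.1 (h.noRec x (U u) (U v) ⟨_, hu, rfl⟩ ⟨_, hv, rfl⟩ huv)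
      have hu' := N.inArc_closed x t _ _ h1
      have hv' := (N.inArc_closed x t).right h1
      cases hinj ⟨x, hu⟩ ⟨x, hu'⟩ e1
      cases hinj ⟨x, hv⟩ ⟨x, hv'⟩ e2
      exact h1
    · intro u v y₁ y₂ hne hu hv x hx
      rw [preItems_eq, postItems_eq]
      exact h.noClone (U u) (U v) y₁ y₂ hne ⟨_, hu, rfl⟩ ⟨_, hv, rfl⟩ x (hx.image _)

theorem role_congr {t : T} {U U' : V → Tok A V} {a a' : Tok A V}
    (h : ∀ u ∈ N.guardVars t, U u = a ↔ U' u = a') : N.role t U a = N.role t U' a' := by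
  classical
  -- The role is a chosen witness, so equal roles are obtained from equality of the predicates
  -- rather than from uniqueness of the witness.
  have key : ∀ p q : V → Prop, p = q →
      (if h : ∃ u, p u then some h.choose else none) =
        if h : ∃ u, q u then some h.choose else none := by
    rintro p _ rfl; rfl
  unfold role
  convert key (fun u => u ∈ N.guardVars t ∧ U u = a) (fun u => u ∈ N.guardVars t ∧ U' u = a')
    (funext fun u => propext (and_congr_right (h u)))

theorem role_eq_some {t : T} {U : V → Tok A V} {a : Tok A V} {u : V}
    (h : N.role t U a = some u) : u ∈ N.guardVars t ∧ U u = a := by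
  unfold role at h
  split_ifs at h with hu
  · cases h
    exact hu.choose_spec

theorem role_apply {t : T} {U : V → Tok A V} (hU : Set.InjOn U (N.guardVars t)) {u : V}
    (hu : u ∈ N.guardVars t) : N.role t U (U u) = some u := by
  have h : ∃ v ∈ N.guardVars t, U v = U u := ⟨u, hu, rfl⟩
  rw [role, dif_pos h]
  exact congrArg some (hU h.choose_spec.1 hu h.choose_spec.2)

/-! ### Forward steps with arbitrary fresh keys -/

variable (N)

/-- The memory added to the instance `a` by the occurrence `(t, k)`. -/
noncomputable def stamp (t : T) (k : ℕ) (U : V → Tok A V) (a : Tok A V) : Tok A V :=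
  .mem a k (N.role t U a)

theorem stamp_injective (t : T) (k : ℕ) (U : V → Tok A V) : (N.stamp t k U).Injective :=
  fun _ _ h => (Tok.mem.inj h).1

/-- A forward step with an arbitrary fresh key. -/
structure LStep (S : State P T A V) (t : T) (k : ℕ) (U : V → Tok A V) (S' : State P T A V) :
    Prop where
  inj : Set.InjOn U (N.guardVars t)
  ty : ∀ u ∈ N.guardVars t, N.varTy u = (U u).ty
  move : Move S.M (N.inItems t U) (N.outItems t U)
  fresh : ∀ t', k ∉ S.H t'
  marking : ∀ x, S'.M x = (S.M x \ taken S.M (N.inItems t U) x) ∪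
    Item.map (N.stamp t k U) '' moved S.M (N.inItems t U) (N.outItems t U) x
  hist : ∀ t', S'.H t' = {k' | k' ∈ S.H t' ∨ (t' = t ∧ k' = k)}

/-- Invariants of the states that can be reached with fresh keys. -/
structure Inv (S : State P T A V) : Prop where
  proper : Proper S.M
  origin : ∀ a b x y, Sum.inl a ∈ S.M x → Sum.inl b ∈ S.M y → a.origin = b.origin → a = b
  keys : ∀ a x, Sum.inl a ∈ S.M x → ∀ k ∈ a.keys, ∃ t, k ∈ S.H t
  finite : {k | ∃ t, k ∈ S.H t}.Finite

/-- States reached from initial states by `n` forward steps with fresh keys. -/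
inductive LReach : ℕ → State P T A V → Prop
  | init {S : State P T A V} (h : N.Initial S) : LReach 0 S
  | step {n : ℕ} {S S' : State P T A V} {t : T} {k : ℕ} {U : V → Tok A V} (h : LReach n S)
      (h' : N.LStep S t k U S') : LReach (n + 1) S'

variable {N}

theorem Initial.inv {S : State P T A V} (h : N.Initial S) : Inv S where
  proper := ⟨fun x a b hb => (h.bond x a b hb).1, h.unique⟩
  origin a b x y ha hb hab := by
    obtain ⟨a, i, rfl⟩ := h.base x a ha
    obtain ⟨b, j, rfl⟩ := h.base y b hb
    obtain ⟨rfl, rfl⟩ := Prod.mk.inj hab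
    rfl
  keys a x ha k hk := by
    obtain ⟨a, i, rfl⟩ := h.base x a ha
    exact absurd hk (Set.notMem_empty _)
  finite := by simp [h.hist]

namespace LStep
variable {S S' : State P T A V} {t : T} {k : ℕ} {U : V → Tok A V}

theorem fresh_token (h : N.LStep S t k U S') (hS : Inv S) {a : Tok A V} {x : P}
    (ha : Sum.inl a ∈ S.M x) : k ∉ a.keys := fun hk =>
  let ⟨t', ht'⟩ := hS.keys a x ha k hk
  h.fresh t' ht'

theorem hist_subset (h : N.LStep S t k U S') {t' : T} {k' : ℕ} (hk : k' ∈ S.H t') :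
    k' ∈ S'.H t' := by
  rw [h.hist]; exact Or.inl hk

theorem key_mem (h : N.LStep S t k U S') : k ∈ S'.H t := by
  rw [h.hist]; exact Or.inr ⟨rfl, rfl⟩

theorem token_of_moved (h : N.LStep S t k U S') {a : Tok A V} {x : P}
    (ha : Sum.inl a ∈ moved S.M (N.inItems t U) (N.outItems t U) x) : ∃ y, Sum.inl a ∈ S.M y :=
  let ⟨y, hy⟩ := h.move.inl_mem_total_moved.1 ⟨x, ha⟩
  ⟨y, Move.taken_sub _ _ _ hy⟩

theorem stamp_mem_of_taken (h : N.LStep S t k U S') {a : Tok A V} {x : P}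
    (ha : Sum.inl a ∈ taken S.M (N.inItems t U) x) : ∃ y, Sum.inl (N.stamp t k U a) ∈ S'.M y := by
  obtain ⟨y, hy⟩ := h.move.inl_mem_total_moved.2 ⟨x, ha⟩
  exact ⟨y, by rw [h.marking]; exact Or.inr ⟨_, hy, rfl⟩⟩

theorem persists (h : N.LStep S t k U S') {a : Tok A V} {x : P} (ha : Sum.inl a ∈ S.M x) :
    Sum.inl a ∈ S'.M x ∨ ∃ y, Sum.inl (N.stamp t k U a) ∈ S'.M y := by
  by_cases hx : Sum.inl a ∈ taken S.M (N.inItems t U) x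
  · exact Or.inr (h.stamp_mem_of_taken hx)
  · exact Or.inl (by rw [h.marking]; exact Or.inl ⟨ha, hx⟩)

theorem token_cases (h : N.LStep S t k U S') {b : Tok A V} {x : P} (hb : Sum.inl b ∈ S'.M x) :
    (Sum.inl b ∈ S.M x ∧ Sum.inl b ∉ taken S.M (N.inItems t U) x) ∨
      ∃ a, b = N.stamp t k U a ∧
        Sum.inl a ∈ moved S.M (N.inItems t U) (N.outItems t U) x := by
  rw [h.marking] at hb
  exact hb.imp id Item.inl_mem_image.1

theorem new_token (h : N.LStep S t k U S') (hS : Inv S) {b : Tok A V} {x : P}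
    (hb : Sum.inl b ∈ S'.M x) (hk : k ∈ b.keys) :
    ∃ a, b = N.stamp t k U a ∧
      Sum.inl a ∈ moved S.M (N.inItems t U) (N.outItems t U) x :=
  (h.token_cases hb).resolve_left fun h' => h.fresh_token hS h'.1 hk

/-- Stamped tokens carry the fresh key `k`, which no token of `S` has. -/
theorem apart (h : N.LStep S t k U S') (hS : Inv S) {M : P → Set (Item (Tok A V))}
    (hM : ∀ x, M x ⊆ S.M x) : Apart M fun x =>
      Item.map (N.stamp t k U) '' moved S.M (N.inItems t U) (N.outItems t U) x := by
  intro a x y ha ha'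
  obtain ⟨a, rfl, -⟩ := Item.inl_mem_image.1 ha'
  exact h.fresh_token hS (hM x ha) (Or.inl rfl)

/-- For uniqueness of origins, the critical case is an untouched token against a stamped one: equal
origins would make them the same token of `S`, both taken and not taken. -/
theorem inv (h : N.LStep S t k U S') (hS : Inv S) : Inv S' where
  proper := by
    rw [funext h.marking]
    exact h.move.proper_rest.union (h.move.proper_moved.image (N.stamp_injective t k U))
      (h.apart hS fun x => Set.sdiff_subset)
  origin a b x y ha hb hab := by
    rcases h.token_cases ha with ⟨ha1, ha2⟩ | ⟨a, rfl, ha1⟩ <;>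
      rcases h.token_cases hb with ⟨hb1, hb2⟩ | ⟨b, rfl, hb1⟩
    · exact hS.origin a b x y ha1 hb1 hab
    · obtain ⟨y', hy'⟩ := h.move.inl_mem_total_moved.1 ⟨y, hb1⟩
      have hb2 := Move.taken_sub _ _ _ hy'
      cases hS.origin a b x y' ha1 hb2 hab
      cases hS.proper.unique a x y' ha1 hb2
      exact absurd hy' ha2
    · obtain ⟨x', hx'⟩ := h.move.inl_mem_total_moved.1 ⟨x, ha1⟩
      have ha2 := Move.taken_sub _ _ _ hx'
      cases hS.origin a b x' y ha2 hb1 hab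
      cases hS.proper.unique _ x' y ha2 hb1
      exact absurd hx' hb2
    · obtain ⟨x', hx'⟩ := h.token_of_moved ha1
      obtain ⟨y', hy'⟩ := h.token_of_moved hb1
      rw [hS.origin a b x' y' hx' hy' hab]
  keys a x ha l hl := by
    rcases h.token_cases ha with ⟨ha1, -⟩ | ⟨a, rfl, ha1⟩
    · obtain ⟨t', ht'⟩ := hS.keys a x ha1 l hl
      exact ⟨t', h.hist_subset ht'⟩
    · rcases hl with rfl | hl
      · exact ⟨t, h.key_mem⟩
      · obtain ⟨y, hy⟩ := h.token_of_moved ha1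
        obtain ⟨t', ht'⟩ := hS.keys a y hy l hl
        exact ⟨t', h.hist_subset ht'⟩
  finite := by
    refine (hS.finite.insert k).subset ?_
    rintro l ⟨t', hl⟩
    rw [h.hist] at hl
    rcases hl with hl | ⟨-, rfl⟩
    · exact Or.inr ⟨t', hl⟩
    · exact Or.inl rfl

/-- Independent steps can be exchanged. -/
theorem swap {Q R : State P T A V} {t₁ t₂ : T} {k₁ k₂ : ℕ} {U₁ U₂ : V → Tok A V} (hS : Inv S)
    (h₁ : N.LStep S t₁ k₁ U₁ Q) (h₂ : N.LStep Q t₂ k₂ U₂ R)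
    (hind : ∀ a r x, Sum.inl (Tok.mem a k₁ r) ∉ taken Q.M (N.inItems t₂ U₂) x) :
    ∃ Q', N.LStep S t₂ k₂ U₂ Q' ∧ N.LStep Q' t₁ k₁ U₁ R := by
  have hQ := h₁.inv hS
  set A₁ := taken S.M (N.inItems t₁ U₁) with hA₁
  set A₁' := fun x => Item.map (N.stamp t₁ k₁ U₁) ''
    moved S.M (N.inItems t₁ U₁) (N.outItems t₁ U₁) x with hA₁'
  set A₂ := taken Q.M (N.inItems t₂ U₂) with hA₂
  set A₂' := fun x => Item.map (N.stamp t₂ k₂ U₂) ''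
    moved Q.M (N.inItems t₂ U₂) (N.outItems t₂ U₂) x with hA₂'
  set E := fun x => (S.M x \ A₁ x) \ A₂ x with hE
  have pA₁ : Proper A₁ := h₁.move.proper_taken
  have pB₁ : Proper fun x => S.M x \ A₁ x := h₁.move.proper_rest
  have pA₁' : Proper A₁' := h₁.move.proper_moved.image (N.stamp_injective _ _ _)
  have pA₂ : Proper A₂ := h₂.move.proper_taken
  have pA₂' : Proper A₂' := h₂.move.proper_moved.image (N.stamp_injective _ _ _)
  have hQM : ∀ x, Q.M x = (S.M x \ A₁ x) ∪ A₁' x := h₁.marking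
  have subA₁ : ∀ x, A₁ x ⊆ S.M x := Move.taken_sub _ _
  -- Independence says that the second step takes nothing stamped by the first, hence only what the
  -- first left in place.
  have subA₂ : ∀ x, A₂ x ⊆ S.M x \ A₁ x := by
    intro x e he
    have he' := Move.taken_sub _ _ _ he
    rw [hQM] at he'
    refine he'.resolve_right fun h => ?_
    obtain ⟨a, h1, h2⟩ := exists_token_of_mem (pA₁'.closed x) h
    obtain ⟨b, rfl, -⟩ := Item.inl_mem_image.1 h1
    exact hind _ _ _ (h2 _ (pA₂.closed x) he)
  have pE : Proper E := by
    refine ⟨fun x a b => ?_, fun a x y h1 h2 => pB₁.unique a x y h1.1 h2.1⟩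
    rintro ⟨h1, h2⟩
    refine ⟨pB₁.closed x _ _ h1, fun h3 => h2 (h₂.move.inr_mem_taken.2 ⟨?_, h3⟩)⟩
    rw [hQM]
    exact Or.inl h1
  have aA₁B₁ : Apart A₁ fun x => S.M x \ A₁ x := fun a x y h1 h2 => by
    cases hS.proper.unique a x y (subA₁ x h1) h2.1
    exact h2.2 h1
  have aA₂E : Apart A₂ E := fun a x y h1 h2 => by
    cases pB₁.unique a x y (subA₂ x h1) h2.1
    exact h2.2 h1
  have aA₁E : Apart A₁ E := fun a x y h1 h2 => aA₁B₁ a x y h1 h2.1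
  have aA₂A₁ : Apart A₂ A₁ := fun a x y h1 h2 => aA₁B₁ a y x h2 (subA₂ x h1)
  have aA₂A₁' : Apart A₂ A₁' := h₁.apart hS fun x => (subA₂ x).trans Set.sdiff_subset
  have aEA₁' : Apart E A₁' :=
    h₁.apart hS fun x => Set.sdiff_subset.trans Set.sdiff_subset
  have k₂S : ∀ a x, Sum.inl a ∈ S.M x → k₂ ∉ a.keys := fun a x ha hk =>
    let ⟨t', ht'⟩ := hS.keys a x ha k₂ hk
    h₂.fresh t' (h₁.hist_subset ht')
  have aSA₂' : ∀ {M : P → Set (Item (Tok A V))}, (∀ x, M x ⊆ S.M x) → Apart M A₂' := by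
    intro M hM a x y h1 h2
    obtain ⟨a, rfl, -⟩ := Item.inl_mem_image.1 h2
    exact k₂S _ x (hM x h1) (Or.inl rfl)
  have aA₁A₂' : Apart A₁ A₂' := aSA₂' subA₁
  have aEA₂' : Apart E A₂' := aSA₂' fun x => Set.sdiff_subset.trans Set.sdiff_subset
  -- The marking splits into what each step takes and the rest `E`. The first step changes only the
  -- part `A₁`, so the second may act in either context.
  have hSM : S.M = fun x => A₂ x ∪ (A₁ x ∪ E x) := by
    funext x
    ext e
    have h1 := @subA₁ x e
    have h2 := @subA₂ x e
    simp only [hE, Set.mem_union, Set.mem_sdiff] at h2 ⊢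
    tauto
  have hQM' : Q.M = fun x => A₂ x ∪ (A₁' x ∪ E x) := by
    funext x
    rw [hQM]
    ext e
    have h2 := @subA₂ x e
    simp only [hE, Set.mem_union, Set.mem_sdiff] at h2 ⊢
    tauto
  have hSM' : S.M = fun x => A₁ x ∪ (S.M x \ A₁ x) := by
    funext x
    exact (Set.union_sdiff_cancel (subA₁ x)).symm
  have pA₁E : Proper fun x => A₁ x ∪ E x := pA₁.union pE aA₁E
  have pA₁'E : Proper fun x => A₁' x ∪ E x := pA₁'.union pE fun a x y h1 h2 => aEA₁' a y x h2 h1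
  have apart₁ : Apart A₂ fun x => A₁ x ∪ E x := fun a x y h1 h2 =>
    h2.elim (aA₂A₁ a x y h1) (aA₂E a x y h1)
  have apart₂ : Apart A₂ fun x => A₁' x ∪ E x := fun a x y h1 h2 =>
    h2.elim (aA₂A₁' a x y h1) (aA₂E a x y h1)
  have m₂ : Move A₂ (N.inItems t₂ U₂) (N.outItems t₂ U₂) := by
    have := h₂.move
    rw [hQM'] at this
    exact this.of_union pA₁'E apart₂ pA₂ h₂.move.in_sub_taken
  have m₂S : Move S.M (N.inItems t₂ U₂) (N.outItems t₂ U₂) := by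
    rw [hSM]
    exact m₂.union pA₁E apart₁
  have taken₂ : ∀ x, taken S.M (N.inItems t₂ U₂) x = A₂ x := by
    intro x
    conv_lhs => rw [hSM]
    rw [taken_union pA₁E apart₁ m₂, ← taken_union pA₁'E apart₂ m₂, ← hQM']
  have moved₂ : ∀ x, moved S.M (N.inItems t₂ U₂) (N.outItems t₂ U₂) x =
      moved Q.M (N.inItems t₂ U₂) (N.outItems t₂ U₂) x := by
    intro x
    conv_lhs => rw [hSM]
    rw [moved_union pA₁E apart₁ m₂, ← moved_union pA₁'E apart₂ m₂, ← hQM']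
  have m₁ : Move A₁ (N.inItems t₁ U₁) (N.outItems t₁ U₁) := by
    have := h₁.move
    rw [hSM'] at this
    exact this.of_union pB₁ aA₁B₁ pA₁ h₁.move.in_sub_taken
  have pEA₂' : Proper fun x => E x ∪ A₂' x := pE.union pA₂' aEA₂'
  have apart₃ : Apart A₁ fun x => E x ∪ A₂' x := fun a x y h1 h2 =>
    h2.elim (aA₁E a x y h1) (aA₁A₂' a x y h1)
  have rest₂ : ∀ x, S.M x \ A₂ x = A₁ x ∪ E x := fun x => by
    rw [congrFun hSM x]
    exact union_diff_of_apart pA₂ pA₁E apart₁ x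
  have taken₁ : ∀ x, taken (fun x => A₁ x ∪ (E x ∪ A₂' x)) (N.inItems t₁ U₁) x = A₁ x := by
    intro x
    rw [taken_union pEA₂' apart₃ m₁, ← taken_union pB₁ aA₁B₁ m₁, ← hSM']
  have moved₁ : ∀ x, moved (fun x => A₁ x ∪ (E x ∪ A₂' x)) (N.inItems t₁ U₁)
      (N.outItems t₁ U₁) x = moved S.M (N.inItems t₁ U₁) (N.outItems t₁ U₁) x := by
    intro x
    rw [moved_union pEA₂' apart₃ m₁, ← moved_union pB₁ aA₁B₁ m₁, ← hSM']
  -- The new intermediate state has the output of the second step in place, with the part for the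
  -- first still untouched.
  refine ⟨⟨fun x => A₁ x ∪ (E x ∪ A₂' x), fun t' => {k' | k' ∈ S.H t' ∨ (t' = t₂ ∧ k' = k₂)}⟩,
    ?_, ?_⟩
  · refine ⟨h₂.inj, h₂.ty, m₂S, fun t' ht' => h₂.fresh t' (h₁.hist_subset ht'), fun x => ?_,
      fun t' => rfl⟩
    rw [taken₂, moved₂, rest₂]
    exact (Set.union_assoc _ _ _).symm
  · refine ⟨h₁.inj, h₁.ty, m₁.union pEA₂' apart₃, ?_, fun x => ?_, fun t' => ?_⟩
    · rintro t' (ht' | ⟨rfl, rfl⟩)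
      · exact h₁.fresh t' ht'
      · exact h₂.fresh _ h₁.key_mem
    · rw [h₂.marking]
      show _ = ((A₁ x ∪ (E x ∪ A₂' x)) \ _) ∪ _
      rw [taken₁, moved₁, union_diff_of_apart pA₁ pEA₂' apart₃]
      have h3 : Q.M x \ A₂ x = A₁' x ∪ E x := by
        rw [congrFun hQM' x]
        exact union_diff_of_apart pA₂ pA₁'E apart₂ x
      show (Q.M x \ A₂ x) ∪ A₂' x = (E x ∪ A₂' x) ∪ A₁' x
      rw [h3, Set.union_assoc, Set.union_comm]
    · rw [h₂.hist, h₁.hist]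
      ext l
      simp only [Set.mem_ofPred_eq]
      tauto

end LStep

theorem LReach.inv {n : ℕ} {S : State P T A V} (h : N.LReach n S) : Inv S := by
  induction h with
  | init h => exact h.inv
  | step _ h' ih => exact h'.inv ih

/-- An occurrence on which no other depends can be taken to be the last one. -/
theorem LReach.pull {n : ℕ} {S : State P T A V} (h : N.LReach n S) {t : T} {k : ℕ}
    (hk : k ∈ S.H t)
    (hlast : ∀ b l u x, Sum.inl (Tok.mem b l u) ∈ S.M x → k ∉ b.keys) :
    ∃ m S' U, n = m + 1 ∧ N.LReach m S' ∧ N.LStep S' t k U S := by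
  induction h with
  | init h =>
    rw [h.hist] at hk
    exact absurd hk (Set.notMem_empty _)
  | @step n Q S t' k' U' hQ h' ih =>
    rw [h'.hist] at hk
    rcases hk with hk | ⟨rfl, rfl⟩
    -- The occurrence is made last in the shorter run and then exchanged with the final step. If the
    -- final step took a token stamped by it, `k` would end up beneath a newer memory in `S`,
    -- against `hlast`.
    · obtain ⟨m, Q', U, rfl, h1, h2⟩ := ih hk fun b l u x hx hb => by
        rcases h'.persists hx with h3 | ⟨y, h3⟩
        · exact hlast _ _ _ _ h3 hb
        · exact hlast _ _ _ _ h3 (Or.inr hb)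
      obtain ⟨Q'', h3, h4⟩ := h2.swap h1.inv h' fun a r x hx => by
        obtain ⟨y, hy⟩ := h'.stamp_mem_of_taken hx
        exact hlast _ _ _ _ hy (Or.inl rfl)
      exact ⟨m + 1, Q'', U, rfl, h1.step h3, h4⟩
    · exact ⟨n, Q, U', rfl, hQ, h'⟩

/-- Later memories have larger keys in all the tokens of the state. -/
def MonoKeys (S : State P T A V) : Prop := ∀ a x, Sum.inl a ∈ S.M x → a.Mono

theorem LStep.monoKeys_left {S S' : State P T A V} {t : T} {k : ℕ} {U : V → Tok A V}
    (h : N.LStep S t k U S') (hS' : MonoKeys S') : MonoKeys S := by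
  intro a x ha
  rcases h.persists ha with h1 | ⟨y, h1⟩
  · exact hS' _ _ h1
  · exact (hS' _ _ h1).1

/-- Freshness of a key is invariant under every permutation, whereas being one more than the maximum
is not; this is a further reason for arbitrary fresh keys. -/
theorem LStep.rekey {S S' : State P T A V} {t : T} {k : ℕ} {U : V → Tok A V}
    (h : N.LStep S t k U S') (φ : Equiv.Perm ℕ) :
    N.LStep (S.rekey φ) t (φ k) (fun u => (U u).rekey φ) (S'.rekey φ) := by
  have hφ : (Tok.rekey φ : Tok A V → Tok A V).Injective := Tok.rekey_injective φ.injective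
  have hI : N.inItems t (fun u => (U u).rekey φ) =
      fun x => Item.map (Tok.rekey φ) '' N.inItems t U x := by
    funext x
    simp only [inItems, Set.image_image, Item.map_comp]
  have hO : N.outItems t (fun u => (U u).rekey φ) =
      fun x => Item.map (Tok.rekey φ) '' N.outItems t U x := by
    funext x
    simp only [outItems, Set.image_image, Item.map_comp]
  have hrole : ∀ a, N.role t (fun u => (U u).rekey φ) (a.rekey φ) = N.role t U a := by
    exact fun a => role_congr fun u _ => hφ.eq_iff
  refine ⟨?_, ?_, ?_, ?_, ?_, ?_⟩
  · exact fun u hu v hv huv => h.inj hu hv (hφ huv)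
  · intro u hu
    rw [Tok.ty_rekey, h.ty u hu]
  · rw [hI, hO]
    exact h.move.image hφ
  · rintro t' ⟨l, hl, e⟩
    cases φ.injective e
    exact h.fresh t' hl
  · intro x
    show Item.map (Tok.rekey φ) '' S'.M x = _
    rw [hI, hO]
    show _ = (Item.map (Tok.rekey φ) '' S.M x \
      taken (fun x => Item.map (Tok.rekey φ) '' S.M x) _ x) ∪
        _ '' moved (fun x => Item.map (Tok.rekey φ) '' S.M x) _ _ x
    rw [taken_image hφ, moved_image hφ, h.marking, Set.image_union,
      Set.image_sdiff (Item.map_injective hφ), Set.image_image, Set.image_image]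
    congr 2
    funext e
    rw [Item.map_comp, Item.map_comp]
    congr 1
    funext a
    simp only [stamp, hrole, Tok.rekey]
  · intro t'
    show φ '' S'.H t' = _
    rw [h.hist]
    ext l
    constructor
    · rintro ⟨l, hl | ⟨rfl, rfl⟩, rfl⟩
      · exact Or.inl ⟨l, hl, rfl⟩
      · exact Or.inr ⟨rfl, rfl⟩
    · rintro (⟨l, hl, rfl⟩ | ⟨rfl, rfl⟩)
      · exact ⟨l, Or.inl hl, rfl⟩
      · exact ⟨k, Or.inr ⟨rfl, rfl⟩, rfl⟩

theorem items_congr {t : T} {U U' : V → Tok A V} (hN : N.WellFormed)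
    (h : ∀ u ∈ N.guardVars t, U u = U' u) :
    N.inItems t U = N.inItems t U' ∧ N.outItems t U = N.outItems t U' := by
  constructor <;> funext x
  · exact Item.map_image_congr (N.inArc_closed x t) fun u hu => h u ⟨x, hu⟩
  · exact Item.map_image_congr (N.outArc_closed t x) fun u hu => h u ((hN t).1 ▸ ⟨x, hu⟩)

/-- The result of a step is determined by the tokens assigned to the variables. -/
theorem LStep.det (hN : N.WellFormed) {S S' S'' : State P T A V} {t : T} {k : ℕ}
    {U U' : V → Tok A V} (h : N.LStep S t k U S') (h' : N.LStep S t k U' S'')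
    (hU : ∀ u ∈ N.guardVars t, U u = U' u) : S' = S'' := by
  obtain ⟨hI, hO⟩ := items_congr hN hU
  have hs : N.stamp t k U = N.stamp t k U' := by
    funext a
    exact congrArg _ (role_congr fun u hu => by rw [hU u hu])
  ext x e
  · rw [h.marking, h'.marking, hI, hO, hs]
  · rw [h.hist, h'.hist]

/-! ### Causal-order reversals as inverses of fresh-key steps -/

/-- The last occurrence can be undone. -/
theorem LStep.undo (hN : N.WellFormed) {S S' : State P T A V} {t : T} {k : ℕ} {U : V → Tok A V}
    (h : N.LStep S' t k U S) (hS' : Inv S') (hS : MonoKeys S) :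
    N.RevStepWith S t k (fun u => Tok.mem (U u) k (some u)) S' := by
  have hs := N.stamp_injective t k U
  -- On the variables of `t` this assignment is `U` followed by stamping, so the reversal is the
  -- stamped image of the reverse move.
  obtain ⟨hI, hO⟩ := items_congr (U := fun u => Tok.mem (U u) k (some u))
    (U' := fun u => N.stamp t k U (U u)) (t := t) hN fun u hu => by
      rw [stamp, role_apply h.inj hu]
  have hI' : N.inItems t (fun u => N.stamp t k U (U u)) =
      fun x => Item.map (N.stamp t k U) '' N.inItems t U x := by
    funext x
    simp only [inItems, Set.image_image, Item.map_comp]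
  have hO' : N.outItems t (fun u => N.stamp t k U (U u)) =
      fun x => Item.map (N.stamp t k U) '' N.outItems t U x := by
    funext x
    simp only [outItems, Set.image_image, Item.map_comp]
  have hap := h.apart hS' (M := fun x => S'.M x \ taken S'.M (N.inItems t U) x)
    fun x => Set.sdiff_subset
  have hap' := fun a x y h1 h2 => hap a y x h2 h1
  have hSM : S.M = fun x => Item.map (N.stamp t k U) ''
      moved S'.M (N.inItems t U) (N.outItems t U) x ∪
        (S'.M x \ taken S'.M (N.inItems t U) x) := by
    funext x
    rw [h.marking, Set.union_comm]
  have hpm := h.move.proper_moved.image hs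
  have hrev := h.move.reverse.image hs
  have hRI : ∀ x, N.revIn S t (fun u => Tok.mem (U u) k (some u)) x =
      Item.map (N.stamp t k U) '' moved S'.M (N.inItems t U) (N.outItems t U) x := by
    intro x
    rw [revIn_eq, hO, hO', hSM, taken_union h.move.proper_rest hap' hrev, taken_image hs,
      h.move.taken_reverse]
  have hRO : ∀ x, N.revOut S t (fun u => Tok.mem (U u) k (some u)) x =
      Item.map (N.stamp t k U) '' taken S'.M (N.inItems t U) x := by
    intro x
    rw [revOut_eq, hO, hO', hI, hI', hSM, moved_union h.move.proper_rest hap' hrev,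
      moved_image hs, h.move.moved_reverse]
  have hout : ∀ x l, l ∈ N.outArc t x →
      Item.map (fun u => Tok.mem (U u) k (some u)) l ∈ S.M x := by
    intro x l hl
    have h1 : Item.map (fun u => Tok.mem (U u) k (some u)) l ∈
        N.outItems t (fun u => Tok.mem (U u) k (some u)) x := ⟨l, hl, rfl⟩
    rw [hO, hO'] at h1
    rw [h.marking]
    exact Or.inr (Set.image_mono (h.move.out_sub_moved x) h1)
  refine ⟨⟨h.key_mem, ?_, ?_, ?_, ?_⟩, ?_, ?_⟩
  -- A token with key `k` has just been stamped, so `k` is its outermost and, by monotonicity,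
  -- largest key: no later occurrence depends on it.
  · rintro ⟨t', k'⟩ ⟨-, -, hlt, x, a, b, u, b', u', ha, h1, h2⟩
    obtain ⟨c, rfl, -⟩ := h.new_token hS' ha h1.mem_keys
    rcases h2.mem_keys with rfl | h3
    · exact lt_irrefl _ hlt
    · exact lt_asymm hlt ((hS _ _ ha).2 _ h3)
  · rw [← (hN t).1]
    exact fun u hu v hv huv => h.inj hu hv (Tok.mem.inj huv).1
  · exact fun x u hu => ⟨⟨_, rfl⟩, hout x _ hu, h.ty u ((hN t).1 ▸ ⟨x, hu⟩)⟩
  · exact fun x u v huv => hout x _ huv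
  · intro x
    rw [hRI, hRO]
    have h1 : S.M x \ Item.map (N.stamp t k U) ''
        moved S'.M (N.inItems t U) (N.outItems t U) x =
        S'.M x \ taken S'.M (N.inItems t U) x := by
      rw [congrFun hSM x]
      exact union_diff_of_apart hpm h.move.proper_rest hap' x
    have hsub := Move.taken_sub S'.M (N.inItems t U) x
    rw [h1]
    refine (Set.sdiff_union_of_subset hsub).symm.trans (congrArg _ ?_)
    apply item_ext
    · intro a
      constructor
      · exact fun ha => Or.inl ⟨a, _, rfl, _, ha, rfl⟩
      · rintro (⟨a, u, e, h2⟩ | ⟨a, u, b, v, e, h2⟩)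
        · cases e
          obtain ⟨a', e, h3⟩ := Item.inl_mem_image.1 h2
          cases (Tok.mem.inj e).1
          exact h3
        · cases e
    · intro a b
      constructor
      · exact fun ha => Or.inr ⟨a, _, b, _, rfl, _, ha, rfl⟩
      · rintro (⟨a, u, e, h2⟩ | ⟨c, u, d, v, e, h2⟩)
        · cases e
        · obtain ⟨a', b', e1, e2, h3⟩ := Item.inr_mem_image.1 h2
          cases (Tok.mem.inj e1).1
          cases (Tok.mem.inj e2).1
          rw [e]
          exact h3
  · intro t'
    rw [h.hist]
    ext l
    constructor
    · intro hl
      refine ⟨Or.inl hl, ?_⟩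
      rintro ⟨rfl, rfl⟩
      exact h.fresh _ hl
    · rintro ⟨hl | hl, h2⟩
      · exact hl
      · exact absurd hl h2

/-- The token in a given role of an occurrence is determined. -/
theorem LStep.eq_of_token {S S' : State P T A V} {t : T} {k : ℕ} {U : V → Tok A V}
    (h : N.LStep S t k U S') (hS : Inv S) {a : Tok A V} {u : V} {x : P}
    (ha : Sum.inl (Tok.mem a k (some u)) ∈ S'.M x) : u ∈ N.guardVars t ∧ U u = a := by
  obtain ⟨b, e, -⟩ := h.new_token hS ha (Or.inl rfl)
  obtain ⟨rfl, -, e⟩ := Tok.mem.inj e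
  exact role_eq_some e.symm

theorem LStep.exists_token {S S' : State P T A V} {t : T} {k : ℕ} {U : V → Tok A V}
    (h : N.LStep S t k U S') {u : V} (hu : u ∈ N.guardVars t) :
    ∃ x, Sum.inl (Tok.mem (U u) k (some u)) ∈ S'.M x := by
  obtain ⟨x, hx⟩ := hu
  rw [← role_apply h.inj ⟨x, hx⟩]
  exact h.stamp_mem_of_taken (h.move.in_sub_taken x ⟨_, hx, rfl⟩)

/-- Reversals are determined. -/
theorem LStep.rev_eq (hN : N.WellFormed) {S S' S'' : State P T A V} {t : T} {k : ℕ}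
    {U U' : V → Tok A V} (h : N.LStep S' t k U S) (hS' : Inv S') (hS : MonoKeys S)
    (h' : N.RevStepWith S t k U' S'') : S'' = S' := by
  have h1 := h.undo hN hS' hS
  -- The memory with key `k` and role `u` identifies the token, leaving no choice of assignment.
  have hU : ∀ u ∈ N.guardVars t, U' u = Tok.mem (U u) k (some u) := by
    intro u hu
    obtain ⟨x, hx⟩ : u ∈ N.effectVars t := (hN t).1 ▸ hu
    obtain ⟨⟨a, ha⟩, h2, -⟩ := h'.enabled.tokens x u hx
    rw [ha] at h2 ⊢
    rw [(h.eq_of_token hS' h2).2]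
  obtain ⟨hI, hO⟩ := items_congr hN hU
  ext x e
  · rw [h1.marking, h'.marking]
    simp only [revIn_eq, revOut_eq, hI, hO]
  · rw [h1.hist, h'.hist]

/-- Causal-order reversals undo steps with fresh keys. -/
theorem RevStepWith.lstep (hN : N.WellFormed) {n : ℕ} {S S' : State P T A V} {t : T} {k : ℕ}
    {U : V → Tok A V} (hS : N.LReach n S) (hm : MonoKeys S) (h : N.RevStepWith S t k U S') :
    ∃ m U', n = m + 1 ∧ N.LReach m S' ∧ N.LStep S' t k U' S := by
  -- A memory with key `l` above one with key `k` would, by monotonicity, be an occurrence depending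
  -- on `(t, k)`, which enabledness of the reversal excludes.
  obtain ⟨m, S'', U', rfl, h1, h2⟩ := hS.pull h.enabled.occ fun b l u x hx hk => by
    obtain ⟨t', ht'⟩ := hS.inv.keys _ x hx l (Or.inl rfl)
    obtain ⟨c, v, hc⟩ := Tok.exists_evolvedTo hk
    exact h.enabled.last (t', l) ⟨h.enabled.occ, ht', (hm _ _ hx).2 _ hk, x, _, c, v, b, u, hx,
      hc.mem _ _, .refl⟩
  cases h2.rev_eq hN h1.inv hm h
  exact ⟨m, U', rfl, h1, h2⟩

theorem FwdStepWith.lstep (hN : N.WellFormed) {S S' : State P T A V} {t : T} {k : ℕ}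
    {U : V → Tok A V} (hS : Inv S) (h : N.FwdStepWith S t k U S') :
    N.LStep S t k U S' ∧ ∀ t', ∀ l ∈ S.H t', l < k := by
  obtain ⟨m, hm, rfl⟩ := h.key
  have hlt : ∀ t', ∀ l ∈ S.H t', l < m + 1 := fun t' l hl =>
    Nat.lt_succ_of_le (hm.2 (Or.inr ⟨t', hl⟩))
  obtain ⟨h1, h2, h3⟩ := (fwdEnabled_iff hN hS.proper).1 h.enabled
  refine ⟨⟨h1, h2, h3, fun t' ht' => lt_irrefl _ (hlt t' _ ht'), fun x => ?_, h.hist⟩, hlt⟩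
  rw [h.marking, fwdIn_eq, fwdOut_eq]
  rfl

/-- Enabled transitions can be executed. -/
theorem FwdEnabled.exists_step {S : State P T A V} (hS : Inv S) {t : T} {U : V → Tok A V}
    (h : N.FwdEnabled S t U) : ∃ k S', N.FwdStepWith S t k U S' := by
  obtain ⟨m, hm⟩ : ∃ m, IsGreatest ({0} ∪ {k' | ∃ t', k' ∈ S.H t'}) m := by
    obtain ⟨m, hm, hm'⟩ := Set.exists_max_image ({0} ∪ {k' | ∃ t', k' ∈ S.H t'}) id
      ((Set.finite_singleton 0).union hS.finite) ⟨0, Or.inl rfl⟩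
    exact ⟨m, hm, hm'⟩
  exact ⟨m + 1, ⟨_, _⟩, h, ⟨m, hm, rfl⟩, fun x => rfl, fun t' => rfl⟩

/-! ### Valid states and their preservation by executions -/

variable (N)

/-- States reached with fresh keys, all memories of which have been added in the order of keys. -/
def Valid (S : State P T A V) : Prop := MonoKeys S ∧ ∃ n, N.LReach n S

variable {N}

theorem LStep.valid {S S' : State P T A V} {t : T} {k : ℕ} {U : V → Tok A V} (hS : N.Valid S)
    (h : N.LStep S t k U S') (hk : ∀ t', ∀ l ∈ S.H t', l < k) : N.Valid S' := by
  obtain ⟨hm, n, hn⟩ := hS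
  refine ⟨fun a x ha => ?_, n + 1, hn.step h⟩
  rcases h.token_cases ha with ⟨ha', -⟩ | ⟨a, rfl, ha'⟩
  · exact hm a x ha'
  · obtain ⟨y, hy⟩ := h.token_of_moved ha'
    refine ⟨hm a y hy, fun l hl => ?_⟩
    obtain ⟨t', ht'⟩ := hn.inv.keys a y hy l hl
    exact hk t' l ht'

theorem Valid.step (hN : N.WellFormed) {S S' : State P T A V} {α : Action T} (hS : N.Valid S)
    (h : N.Step S α S') : N.Valid S' := by
  cases α with
  | fwd t k =>
    obtain ⟨U, h⟩ := h
    obtain ⟨h1, h2⟩ := h.lstep hN hS.2.choose_spec.inv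
    exact h1.valid hS h2
  | rev t k =>
    obtain ⟨U, h⟩ := h
    obtain ⟨hm, n, hn⟩ := hS
    obtain ⟨m, U', -, h1, h2⟩ := h.lstep hN hn hm
    exact ⟨h2.monoKeys_left hm, m, h1⟩

theorem Valid.exec (hN : N.WellFormed) {S S' : State P T A V} (hS : N.Valid S) (e : N.Exec S S') :
    N.Valid S' := by
  induction e with
  | nil => exact hS
  | cons α h e ih => exact ih (hS.step hN h)

theorem Reachable.valid (hN : N.WellFormed) {S : State P T A V} (hS : N.Reachable S) :
    N.Valid S := by
  obtain ⟨S₀, h₀, ⟨e⟩⟩ := hS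
  refine Valid.exec hN ⟨fun a x ha => ?_, 0, .init h₀⟩ e
  obtain ⟨b, i, rfl⟩ := h₀.base x a ha
  trivial

theorem Valid.inv {S : State P T A V} (hS : N.Valid S) : Inv S := hS.2.choose_spec.inv

end MRPN
end MultiRPN
namespace MultiRPN
namespace MRPN
variable {P T A V : Type*} {N : MRPN P T A V}

/-! ### Equivalence of states as renaming of keys -/

theorem Prec.rekey {S : State P T A V} {φ : Equiv.Perm ℕ} (hS : MonoKeys S)
    (hφ : MonoKeys (S.rekey φ)) {o o' : T × ℕ} (h : Prec S o o') :
    Prec (S.rekey φ) (o.1, φ o.2) (o'.1, φ o'.2) := by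
  obtain ⟨h1, h2, hlt, x, a, b, u, b', u', ha, h3, h4⟩ := h
  have ha' : Sum.inl (a.rekey φ) ∈ (S.rekey φ).M x := ⟨_, ha, rfl⟩
  obtain ⟨c, v, hc⟩ := Tok.exists_evolvedTo (a := a.rekey φ) (k := φ o.2)
    (by rw [Tok.keys_rekey]; exact ⟨_, h3.mem_keys, rfl⟩)
  obtain ⟨c', v', hc'⟩ := Tok.exists_evolvedTo (a := a.rekey φ) (k := φ o'.2)
    (by rw [Tok.keys_rekey]; exact ⟨_, h4.mem_keys, rfl⟩)
  exact ⟨⟨_, h1, rfl⟩, ⟨_, h2, rfl⟩,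
    (hS a x ha).lt_of_lt (hφ _ _ ha') h3.mem_keys h4.mem_keys hlt, x, _, c, v, c', v', ha', hc, hc'⟩

theorem CausalPath.rekey {S : State P T A V} {φ : Equiv.Perm ℕ} (hS : MonoKeys S)
    (hφ : MonoKeys (S.rekey φ)) {p : List (T × ℕ)} (h : CausalPath S p) :
    CausalPath (S.rekey φ) (p.map fun o => (o.1, φ o.2)) := by
  obtain ⟨h1, h2, h3⟩ := h
  refine ⟨by simpa using h1, ?_, ?_⟩
  · intro o ho
    obtain ⟨o', ho', rfl⟩ := List.mem_map.1 ho
    exact ⟨_, h2 o' ho', rfl⟩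
  · rw [List.isChain_map]
    exact h3.imp fun _ _ h => h.rekey hS hφ

theorem rekey_symm (S : State P T A V) (φ : Equiv.Perm ℕ) : (S.rekey φ).rekey φ.symm = S := by
  rw [State.rekey_rekey, Equiv.self_trans_symm, State.rekey_refl]

/-- Monotonicity on both sides makes the renaming and its inverse preserve causal dependence, so
`HistEquiv` follows from `MarkEquiv`. -/
theorem stateEquiv_iff {S S' : State P T A V} (hS : MonoKeys S) (hS' : MonoKeys S') :
    StateEquiv S S' ↔ ∃ φ, S' = S.rekey φ := by
  refine ⟨fun h => markEquiv_iff.1 h.1, fun h => ⟨markEquiv_iff.2 h, ?_⟩⟩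
  obtain ⟨φ, rfl⟩ := h
  refine ⟨fun p hp => ⟨_, hp.rekey hS hS', by simp⟩, fun q hq => ?_⟩
  have h := hq.rekey (φ := φ.symm) hS' (by rwa [rekey_symm])
  rw [rekey_symm] at h
  exact ⟨_, h, by simp⟩

theorem Inv.rekey {S : State P T A V} (hS : Inv S) (φ : Equiv.Perm ℕ) : Inv (S.rekey φ) where
  proper := hS.proper.image (Tok.rekey_injective φ.injective)
  origin a b x y ha hb hab := by
    obtain ⟨a, rfl, ha'⟩ := Item.inl_mem_image.1 ha
    obtain ⟨b, rfl, hb'⟩ := Item.inl_mem_image.1 hb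
    rw [Tok.origin_rekey, Tok.origin_rekey] at hab
    rw [hS.origin a b x y ha' hb' hab]
  keys a x ha k hk := by
    obtain ⟨a, rfl, ha'⟩ := Item.inl_mem_image.1 ha
    rw [Tok.keys_rekey] at hk
    obtain ⟨k, hk, rfl⟩ := hk
    obtain ⟨t, ht⟩ := hS.keys a x ha' k hk
    exact ⟨t, k, ht, rfl⟩
  finite := by
    refine (hS.finite.image φ).subset ?_
    rintro _ ⟨t, k, hk, rfl⟩
    exact ⟨k, ⟨t, hk⟩, rfl⟩

/-! ### Steps are determined up to keys by the origins of their tokens -/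

namespace LStep
variable {S S' : State P T A V} {t : T} {k : ℕ} {U : V → Tok A V}

theorem token_mem (h : N.LStep S t k U S') {u : V} (hu : u ∈ N.guardVars t) :
    ∃ x, Sum.inl (U u) ∈ S.M x :=
  let ⟨x, hx⟩ := hu
  ⟨x, h.move.in_sub x ⟨_, hx, rfl⟩⟩

theorem uses_iff (h : N.LStep S t k U S') (hS : Inv S) {u : V} {o : A × ℕ} :
    N.Uses t S'.M k u o ↔ u ∈ N.guardVars t ∧ (U u).origin = o := by
  constructor
  · rintro ⟨hu, x, a, rfl, ha⟩
    rw [(h.eq_of_token hS ha).2]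
    exact ⟨hu, rfl⟩
  · rintro ⟨hu, rfl⟩
    obtain ⟨x, hx⟩ := h.exists_token hu
    exact ⟨hu, x, _, rfl, hx⟩

theorem mem_hist_iff (h : N.LStep S t k U S') {t' : T} : k ∈ S'.H t' ↔ t' = t := by
  rw [h.hist]
  exact ⟨fun h' => h'.elim (fun h' => absurd h' (h.fresh t')) And.left,
    fun h' => Or.inr ⟨h', rfl⟩⟩

/-- A fresh key enters a memory only as its outermost entry. This provides the hypotheses of
`LReach.pull` and `LStep.swap` in the diamond. -/
theorem not_buried (h : N.LStep S t k U S') (hS : Inv S) {b : Tok A V} {l : ℕ} {u : Option V}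
    {x : P} (hb : Sum.inl (Tok.mem b l u) ∈ S'.M x) : k ∉ b.keys := by
  intro hk
  obtain ⟨a, e, ha⟩ := h.new_token hS hb (Or.inr hk)
  cases (Tok.mem.inj e).1
  obtain ⟨y, hy⟩ := h.token_of_moved ha
  exact h.fresh_token hS hy hk

/-- Following `φ` by the transposition of `φ k` and `k₂` aligns the new keys and changes nothing on
`S`, where both keys are fresh after renaming. Tokens are determined by their origins, so both steps
then select the same ones. -/
theorem fwd_det (hN : N.WellFormed) {S₂ : State P T A V} {φ : Equiv.Perm ℕ} {k₂ : ℕ}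
    {U₂ : V → Tok A V} (hS : Inv S) (h : N.LStep S t k U S')
    (h₂ : N.LStep (S.rekey φ) t k₂ U₂ S₂)
    (hU : ∀ u ∈ N.guardVars t, (U u).origin = (U₂ u).origin) : ∃ ψ, S₂ = S'.rekey ψ := by
  have hψ : ∀ t', ∀ l ∈ S.H t', φ l = (φ.trans (Equiv.swap (φ k) k₂)) l := by
    intro t' l hl
    refine (Equiv.swap_apply_of_ne_of_ne (fun e => ?_) fun e => ?_).symm
    · cases φ.injective e
      exact h.fresh t' hl
    · exact h₂.fresh t' ⟨l, hl, e⟩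
  have heq : S.rekey φ = S.rekey (φ.trans (Equiv.swap (φ k) k₂)) := by
    refine State.rekey_congr hS.proper (fun a x ha l hl => ?_) fun t' => ?_
    · obtain ⟨t', ht'⟩ := hS.keys a x ha l hl
      exact hψ t' l ht'
    · exact Set.image_congr (hψ t')
  have h' := h.rekey (φ.trans (Equiv.swap (φ k) k₂))
  have hk : (φ.trans (Equiv.swap (φ k) k₂)) k = k₂ := Equiv.swap_apply_left _ _
  rw [hk, ← heq] at h'
  refine ⟨_, h₂.det hN h' fun u hu => ?_⟩
  obtain ⟨x, hx⟩ := h₂.token_mem hu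
  obtain ⟨y, hy⟩ := h'.token_mem hu
  exact (hS.rekey φ).origin _ _ x y hx hy (by rw [Tok.origin_rekey, hU u hu])

theorem rev_det (hN : N.WellFormed) {S₂ : State P T A V} {φ : Equiv.Perm ℕ} {k₂ : ℕ}
    {U₂ : V → Tok A V} (hS : Inv S) (hS₂ : Inv S₂) (hφ : MonoKeys (S'.rekey φ))
    (h : N.LStep S t k U S') (h₂ : N.LStep S₂ t k₂ U₂ (S'.rekey φ))
    (hU : ∀ u ∈ N.guardVars t, (U u).origin = (U₂ u).origin) : ∃ ψ, S₂ = S.rekey ψ := by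
  -- If `t` has a variable, the token in that role shows `φ k = k₂`. Otherwise neither `φ k` nor
  -- `k₂` occurs in a memory, and for each transition either both or neither are in its history, so
  -- they may be transposed.
  obtain ⟨ψ, h1, h2⟩ : ∃ ψ : Equiv.Perm ℕ, S'.rekey φ = S'.rekey ψ ∧ ψ k = k₂ := by
    by_cases hne : ∃ u, u ∈ N.guardVars t
    · obtain ⟨u, hu⟩ := hne
      refine ⟨φ, rfl, ?_⟩
      obtain ⟨x, hx⟩ := (h.rekey φ).exists_token hu
      obtain ⟨y, hy⟩ := h₂.exists_token hu
      exact (Tok.mem.inj ((h₂.inv hS₂).origin _ _ x y hx hy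
        ((Tok.origin_rekey _ _).trans (hU u hu)))).2.1
    · have hnone : ∀ {S S' : State P T A V} {k U}, N.LStep S t k U S' → Inv S →
          ∀ a x, Sum.inl a ∈ S'.M x → k ∉ a.keys := by
        intro S S' k U h hS a x ha hk
        obtain ⟨b, -, c, y, hc, -⟩ := h.new_token hS ha hk
        obtain ⟨u, -, hu⟩ := N.inl_mem_outItems.1 hc
        exact hne ⟨u, (hN t).1 ▸ ⟨x, hu⟩⟩
      refine ⟨φ.trans (Equiv.swap (φ k) k₂), ?_, Equiv.swap_apply_left _ _⟩
      refine State.rekey_congr (h.inv hS).proper (fun a x ha l hl => ?_) fun t' => ?_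
      · refine (Equiv.swap_apply_of_ne_of_ne (fun e => ?_) fun e => ?_).symm
        · cases φ.injective e
          exact hnone h hS a x ha hl
        · refine hnone h₂ hS₂ (a.rekey φ) x ⟨_, ha, rfl⟩ ?_
          rw [Tok.keys_rekey]
          exact ⟨l, hl, e⟩
      · rw [Equiv.coe_trans, Set.image_comp]
        refine (Set.BijOn.image_eq (Equiv.swap_bijOn_self ?_)).symm
        rw [φ.injective.mem_set_image, h.mem_hist_iff]
        exact h₂.mem_hist_iff.symm
  have h' := h.rekey ψ
  rw [h2, ← h1] at h'
  exact ⟨ψ, (h₂.rev_eq hN hS₂ hφ (h'.undo hN (hS.rekey ψ) hφ)).symm⟩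

/-- The key `k` need not be the one prescribed for a forward step from `S`, so the occurrence is
redone under the prescribed key with the same assignment. This is exactly what the rule
`cancelRevFwd` demands. -/
theorem exists_redo (hN : N.WellFormed) (h : N.LStep S t k U S') (hS : Inv S) :
    ∃ k₂ S₂, N.FwdStepWith S t k₂ U S₂ ∧ N.EquivOcc t S'.M k S₂.M k₂ := by
  obtain ⟨k₂, S₂, h₂⟩ :=
    ((fwdEnabled_iff hN hS.proper).2 ⟨h.inj, h.ty, h.move⟩).exists_step hS
  refine ⟨k₂, S₂, h₂, fun x a u _ ha => ?_⟩
  obtain ⟨b, e, hb⟩ := h.new_token hS ha (Or.inl rfl)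
  obtain ⟨rfl, -, hr⟩ := Tok.mem.inj e
  rw [hr, (h₂.lstep hN hS).1.marking]
  exact Or.inr ⟨_, hb, rfl⟩

end LStep

/-! ### Equivalent executions lead to equivalent states -/

theorem SameAction.symm {S₁ S₁' S₂ S₂' : State P T A V} {α β : Action T}
    (h : N.SameAction S₁ α S₁' S₂ β S₂') : N.SameAction S₂ β S₂' S₁ α S₁' := by
  cases α <;> cases β <;> first | exact h.elim | skip
  all_goals
    obtain ⟨rfl, h⟩ := h
    exact ⟨rfl, fun u o => (h u o).symm⟩

theorem SameAction.trans {S₁ S₁' S₂ S₂' S₃ S₃' : State P T A V} {α β γ : Action T}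
    (h : N.SameAction S₁ α S₁' S₂ β S₂') (h' : N.SameAction S₂ β S₂' S₃ γ S₃') :
    N.SameAction S₁ α S₁' S₃ γ S₃' := by
  cases α <;> cases β <;> first | exact h.elim | skip
  all_goals cases γ <;> first | exact h'.elim | skip
  all_goals
    obtain ⟨rfl, h⟩ := h
    obtain ⟨rfl, h'⟩ := h'
    exact ⟨rfl, fun u o => (h u o).trans (h' u o)⟩

theorem origin_eq_of_uses {S S' Q Q' : State P T A V} {t : T} {k l : ℕ} {U W : V → Tok A V}
    (h : N.LStep S t k U S') (hS : Inv S) (h' : N.LStep Q t l W Q') (hQ : Inv Q)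
    (hu : ∀ u o, N.Uses t S'.M k u o ↔ N.Uses t Q'.M l u o) :
    ∀ u ∈ N.guardVars t, (U u).origin = (W u).origin := fun u hg =>
  ((h.uses_iff hS).1 ((hu u _).2 ((h'.uses_iff hQ).2 ⟨hg, rfl⟩))).2

/-- The same actions lead from equivalent states to equivalent states. -/
theorem SameAction.rekey (hN : N.WellFormed) {S S' Q' : State P T A V} {φ : Equiv.Perm ℕ}
    {α β : Action T} (hS : N.Valid S) (hφ : N.Valid (S.rekey φ)) (h₁ : N.Step S α S')
    (h₂ : N.Step (S.rekey φ) β Q') (h : N.SameAction S α S' (S.rekey φ) β Q') :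
    ∃ ψ, Q' = S'.rekey ψ := by
  cases α <;> cases β <;> first | exact h.elim | skip
  · obtain ⟨rfl, h⟩ := h
    obtain ⟨U, h₁⟩ := h₁
    obtain ⟨W, h₂⟩ := h₂
    have g₁ := (h₁.lstep hN hS.inv).1
    have g₂ := (h₂.lstep hN hφ.inv).1
    exact g₁.fwd_det hN hS.inv g₂ (origin_eq_of_uses g₁ hS.inv g₂ hφ.inv h)
  · obtain ⟨rfl, h⟩ := h
    obtain ⟨U, h₁⟩ := h₁
    obtain ⟨W, h₂⟩ := h₂
    obtain ⟨hm, n, hn⟩ := hS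
    obtain ⟨hm', n', hn'⟩ := hφ
    obtain ⟨_, U, -, r₁, g₁⟩ := h₁.lstep hN hn hm
    obtain ⟨_, W, -, r₂, g₂⟩ := h₂.lstep hN hn' hm'
    exact g₁.rev_det hN r₁.inv r₂.inv hm' g₂ (origin_eq_of_uses g₁ r₁.inv g₂ r₂.inv h)

theorem SameTrace.rekey (hN : N.WellFormed) {S S' Q Q' : State P T A V} {e : N.Exec S S'}
    {f : N.Exec Q Q'} (h : N.SameTrace e f) (hS : N.Valid S) (hQ : N.Valid Q)
    (hSQ : ∃ φ, Q = S.rekey φ) : ∃ ψ, Q' = S'.rekey ψ := by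
  induction h with
  | nil => exact hSQ
  | cons h₁ h₂ h he ih =>
    obtain ⟨φ, rfl⟩ := hSQ
    exact ih (hS.step hN h₁) (hQ.step hN h₂) (h.rekey hN hS hQ h₁ h₂)

theorem rekey_equiv_symm {S Q : State P T A V} : (∃ φ, Q = S.rekey φ) → ∃ φ, S = Q.rekey φ := by
  rintro ⟨φ, rfl⟩
  exact ⟨φ.symm, (rekey_symm S φ).symm⟩

theorem rekey_equiv_trans {S Q R : State P T A V} :
    (∃ φ, Q = S.rekey φ) → (∃ φ, R = Q.rekey φ) → ∃ φ, R = S.rekey φ := by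
  rintro ⟨φ, rfl⟩ ⟨ψ, rfl⟩
  exact ⟨_, State.rekey_rekey φ ψ S⟩

theorem SameAction.rekey_self (hN : N.WellFormed) {S S' Q' : State P T A V} {α β : Action T}
    (hS : N.Valid S) (h₁ : N.Step S α S') (h₂ : N.Step S β Q') (h : N.SameAction S α S' S β Q') :
    ∃ ψ, Q' = S'.rekey ψ := by
  have e := State.rekey_refl S
  exact SameAction.rekey (φ := Equiv.refl ℕ) hN hS (by rwa [e]) h₁ (by rwa [e]) (by rwa [e])

/-- Causally equivalent executions lead to equivalent states. -/
theorem CausEq.rekey (hN : N.WellFormed) {S S₁ S₂ : State P T A V} {e₁ : N.Exec S S₁}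
    {e₂ : N.Exec S S₂} (h : N.CausEq e₁ e₂) (hS : N.Valid S) : ∃ φ, S₂ = S₁.rekey φ := by
  induction h with
  | refl => exact ⟨Equiv.refl ℕ, (State.rekey_refl _).symm⟩
  | symm _ ih => exact rekey_equiv_symm (ih hS)
  | trans _ _ ih ih' => exact rekey_equiv_trans (ih hS) (ih' hS)
  | @comp S₀ S S₁ S₂ _ _ c e₁ e₂ _ _ _ hf ih =>
    have hS' := hS.exec hN c
    exact hf.rekey hN (hS'.exec hN e₁) (hS'.exec hN e₂) (ih hS')
  | @swap S S₁ S₂ S' S'' α₁ α₂ β₁ β₂ h₁ k₂ h₂ k₁ hc s₂ s₁ =>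
    obtain ⟨γ₂, R', γ₁, R'', g₂, r₂, g₁, r₁, hR⟩ := hc
    have hS₁ := hS.step hN h₁
    have hS₂ := hS.step hN h₂
    have e1 := (s₂.symm.trans r₂).rekey_self hN hS₁ k₂ g₂
    have e2 := (s₁.symm.trans r₁).rekey_self hN hS₂ k₁ g₁
    exact rekey_equiv_trans e1 (rekey_equiv_trans (markEquiv_iff.1 hR.1) (rekey_equiv_symm e2))
  | @cancelFwdRev S S' S'' t k h h' =>
    obtain ⟨U, h⟩ := h
    obtain ⟨W, h'⟩ := h'
    have g := (h.lstep hN hS.inv).1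
    have hS' := hS.step hN (α := .fwd t k) ⟨U, h⟩
    cases g.rev_eq hN hS.inv hS'.1 h'
    exact ⟨Equiv.refl ℕ, (State.rekey_refl _).symm⟩
  | @cancelRevFwd S S' S'' t k₁ k₂ h h' heq =>
    have hS' := hS.step hN h
    obtain ⟨U, h⟩ := h
    obtain ⟨W, h'⟩ := h'
    obtain ⟨hm, n, hn⟩ := hS
    obtain ⟨_, U, -, r, g⟩ := h.lstep hN hn hm
    have g' := (h'.lstep hN hS'.inv).1
    have e := State.rekey_refl S'
    refine rekey_equiv_symm (g.fwd_det (φ := Equiv.refl ℕ) (k₂ := k₂) (U₂ := W) hN hS'.inv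
      (by rwa [e]) fun u hu => ?_)
    obtain ⟨x, hx⟩ := g.exists_token hu
    rw [(g'.eq_of_token hS'.inv (heq x _ u hu hx)).2]

/-! ### Executions to equivalent states are equivalent -/

theorem Exec.comp_nil {S S' : State P T A V} (e : N.Exec S S') : e.comp (.nil S') = e := by
  induction e with
  | nil => rfl
  | cons α h e ih => exact congrArg _ ih

theorem CausEq.comp_left {S₀ S S₁ S₂ : State P T A V} (c : N.Exec S₀ S) {e₁ : N.Exec S S₁}
    {e₂ : N.Exec S S₂} (h : N.CausEq e₁ e₂) : N.CausEq (c.comp e₁) (c.comp e₂) := by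
  have := CausEq.comp c h (.nil S₁ S₂)
  rwa [Exec.comp_nil, Exec.comp_nil] at this

theorem CausEq.comp_right {S S₁ S₂ S₁' S₂' : State P T A V} {e₁ : N.Exec S S₁}
    {e₂ : N.Exec S S₂} {f₁ : N.Exec S₁ S₁'} {f₂ : N.Exec S₂ S₂'} (h : N.CausEq e₁ e₂)
    (hf : N.SameTrace f₁ f₂) : N.CausEq (e₁.comp f₁) (e₂.comp f₂) :=
  CausEq.comp (.nil S) h hf

theorem CausEq.cons {S S' S₁ S₂ : State P T A V} {α : Action T} (hα : N.Step S α S')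
    {e₁ : N.Exec S' S₁} {e₂ : N.Exec S' S₂} (h : N.CausEq e₁ e₂) :
    N.CausEq (.cons α hα e₁) (.cons α hα e₂) :=
  CausEq.comp_left (.cons α hα (.nil S')) h

theorem SameAction.refl {S S' : State P T A V} (α : Action T) : N.SameAction S α S' S α S' := by
  cases α <;> exact ⟨rfl, fun _ _ => Iff.rfl⟩

theorem SameTrace.refl {S S' : State P T A V} (e : N.Exec S S') : N.SameTrace e e := by
  induction e with
  | nil => exact .nil _ _
  | cons α h e ih => exact .cons h h (SameAction.refl α) ih

/-- Executions with reversals only. -/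
def Exec.AllRev : {S S' : State P T A V} → N.Exec S S' → Prop
  | _, _, .nil _ => True
  | _, _, .cons (.fwd _ _) _ _ => False
  | _, _, .cons (.rev _ _) _ e => e.AllRev

theorem LReach.exists_allRev (hN : N.WellFormed) {n : ℕ} {S : State P T A V} (h : N.LReach n S)
    (hS : MonoKeys S) : ∃ (Z : State P T A V) (g : N.Exec S Z), g.AllRev ∧ ∀ t, Z.H t = ∅ := by
  induction h with
  | @init S h => exact ⟨S, .nil S, trivial, h.hist⟩
  | @step n S S' t k U h h' ih =>
    obtain ⟨Z, g, h1, h2⟩ := ih (h'.monoKeys_left hS)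
    exact ⟨Z, .cons (.rev t k) ⟨_, h'.undo hN h.inv hS⟩ g, h1, h2⟩

/-- Two different reversals are concurrent. -/
theorem LStep.diamond (hN : N.WellFormed) {n : ℕ} {S S₁ S₂ : State P T A V} {t₁ t₂ : T}
    {k₁ k₂ : ℕ} {U₁ U₂ : V → Tok A V} (hS : MonoKeys S) (r₁ : N.LReach n S₁) (r₂ : Inv S₂)
    (h₁ : N.LStep S₁ t₁ k₁ U₁ S) (h₂ : N.LStep S₂ t₂ k₂ U₂ S) (hk : k₁ ≠ k₂) :
    ∃ m Q W, n = m + 1 ∧ N.LReach m Q ∧ N.LStep Q t₂ k₂ W S₁ ∧ N.LStep Q t₁ k₁ U₁ S₂ ∧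
      N.LStep S₂ t₂ k₂ W S := by
  have hk₂ : k₂ ∈ S₁.H t₂ := by
    have := h₂.key_mem
    rw [h₁.hist] at this
    exact this.resolve_right fun h => hk h.2.symm
  -- The second occurrence is pulled to the end of the run to `S₁`, then exchanged with the first.
  -- Uniqueness of reversals identifies the intermediate state obtained with `S₂`.
  obtain ⟨m, Q, W, rfl, hQ, g⟩ := r₁.pull hk₂ fun b l u x hx hb => by
    rcases h₁.persists hx with h3 | ⟨y, h3⟩
    · exact h₂.not_buried r₂ h3 hb
    · exact h₂.not_buried r₂ h3 (Or.inr hb)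
  obtain ⟨Q', g₁, g₂⟩ := g.swap hQ.inv h₁ fun a r x hx => by
    obtain ⟨y, hy⟩ := h₁.stamp_mem_of_taken hx
    exact h₂.not_buried r₂ hy (Or.inl rfl)
  cases h₂.rev_eq hN r₂ hS (g₂.undo hN (g₁.inv hQ.inv) hS)
  exact ⟨m, Q, W, rfl, hQ, g, g₁, g₂⟩

theorem LReach.hist_nonempty {n : ℕ} {S : State P T A V} (h : N.LReach (n + 1) S) :
    ∃ t, S.H t ≠ ∅ := by
  cases h with
  | step h h' => exact ⟨_, fun e => Set.notMem_empty _ (e ▸ h'.key_mem)⟩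

/-- Any two ways to undo everything are equivalent. -/
theorem causEq_of_allRev (hN : N.WellFormed) {n : ℕ} : ∀ {S Z₁ Z₂ : State P T A V},
    N.LReach n S → MonoKeys S → ∀ {g₁ : N.Exec S Z₁} {g₂ : N.Exec S Z₂}, g₁.AllRev → g₂.AllRev →
      (∀ t, Z₁.H t = ∅) → (∀ t, Z₂.H t = ∅) → N.CausEq g₁ g₂ := by
  induction n with
  | zero =>
    intro S Z₁ Z₂ hS hm g₁ g₂ hg₁ hg₂ _ _
    have key : ∀ {Z} {g : N.Exec S Z}, g.AllRev → N.CausEq g (.nil S) := by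
      intro Z g hg
      cases g with
      | nil => exact .refl _
      | cons α h e =>
        cases α with
        | fwd => exact hg.elim
        | rev =>
          obtain ⟨U, h⟩ := h
          obtain ⟨m, _, e, -⟩ := h.lstep hN hS hm
          exact absurd e (by omega)
    exact (key hg₁).trans (key hg₂).symm
  | succ n ih =>
    intro S Z₁ Z₂ hS hm g₁ g₂ hg₁ hg₂ hZ₁ hZ₂
    obtain ⟨t₀, ht₀⟩ := hS.hist_nonempty
    cases g₁ with
    | nil => exact absurd (hZ₁ t₀) ht₀
    | @cons _ S₁ _ α₁ h₁ e₁ =>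
    cases g₂ with
    | nil => exact absurd (hZ₂ t₀) ht₀
    | @cons _ S₂ _ α₂ h₂ e₂ =>
    cases α₁ with
    | fwd => exact hg₁.elim
    | rev t₁ k₁ =>
    cases α₂ with
    | fwd => exact hg₂.elim
    | rev t₂ k₂ =>
    obtain ⟨n₁, U₁, e, r₁, l₁⟩ := h₁.choose_spec.lstep hN hS hm
    obtain rfl : n = n₁ := by omega
    obtain ⟨n₂, U₂, e, r₂, l₂⟩ := h₂.choose_spec.lstep hN hS hm
    obtain rfl : n = n₂ := by omega
    have m₁ := l₁.monoKeys_left hm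
    have m₂ := l₂.monoKeys_left hm
    by_cases hk : k₁ = k₂
    · subst hk
      obtain rfl : t₁ = t₂ := l₂.mem_hist_iff.1 l₁.key_mem
      obtain rfl : S₁ = S₂ := l₂.rev_eq hN r₂.inv hm (l₁.undo hN r₁.inv hm)
      exact CausEq.cons h₁ (ih r₁ m₁ hg₁ hg₂ hZ₁ hZ₂)
    -- The two first reversals are completed to a square with corner `Q`, and some run `g` of
    -- reversals empties the history from there. By induction each tail is equivalent to the other
    -- side of the square followed by `g`; swapping the square connects them.
    · obtain ⟨m, Q, W, rfl, hQ, g₂₁, g₁₂, l₂'⟩ := l₁.diamond hN hm r₁ r₂.inv l₂ hk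
      obtain ⟨Z, g, hg, hZ⟩ := hQ.exists_allRev hN (g₂₁.monoKeys_left m₁)
      have s₁ : N.Step S₁ (.rev t₂ k₂) Q := ⟨_, g₂₁.undo hN hQ.inv m₁⟩
      have s₂ : N.Step S₂ (.rev t₁ k₁) Q := ⟨_, g₁₂.undo hN hQ.inv m₂⟩
      have c₁ : N.CausEq e₁ (.cons _ s₁ g) := ih r₁ m₁ hg₁ hg hZ₁ hZ
      have c₂ : N.CausEq e₂ (.cons _ s₂ g) := ih r₂ m₂ hg₂ hg hZ₂ hZ
      have a₂ : N.SameAction S (.rev t₂ k₂) S₂ S₁ (.rev t₂ k₂) Q :=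
        ⟨rfl, fun u o => (l₂'.uses_iff r₂.inv).trans (g₂₁.uses_iff hQ.inv).symm⟩
      have a₁ : N.SameAction S (.rev t₁ k₁) S₁ S₂ (.rev t₁ k₁) Q :=
        ⟨rfl, fun u o => (l₁.uses_iff r₁.inv).trans (g₁₂.uses_iff hQ.inv).symm⟩
      have mQ := g₂₁.monoKeys_left m₁
      have hc : N.Concurrent S (.rev t₁ k₁) S₁ (.rev t₂ k₂) S₂ :=
        ⟨_, Q, _, Q, s₁, a₂, s₂, a₁,
          (stateEquiv_iff mQ mQ).2 ⟨Equiv.refl ℕ, (State.rekey_refl Q).symm⟩⟩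
      exact ((CausEq.cons h₁ c₁).trans
        (CausEq.comp_right (.swap h₁ s₁ h₂ s₂ hc a₂ a₁) (SameTrace.refl g))).trans
          (CausEq.cons h₂ c₂).symm

/-- Forward steps are eliminated from the end. After a forward step, the remaining run of reversals
is equivalent to one that begins by undoing that very step, since all ways to undo everything agree;
the pair then cancels. -/
theorem Exec.exists_allRev (hN : N.WellFormed) {S Z : State P T A V} (e : N.Exec S Z)
    (hS : N.Valid S) (hZ : ∀ t, Z.H t = ∅) :
    ∃ (Z' : State P T A V) (g : N.Exec S Z'), g.AllRev ∧ (∀ t, Z'.H t = ∅) ∧ N.CausEq e g := by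
  induction e with
  | nil S => exact ⟨S, .nil S, trivial, hZ, .refl _⟩
  | @cons S S' Z α h e ih =>
    have hS' := hS.step hN h
    obtain ⟨Z₁, g₁, hg₁, hZ₁, hc⟩ := ih hS' hZ
    cases α with
    | rev t k => exact ⟨Z₁, .cons _ h g₁, hg₁, hZ₁, CausEq.cons h hc⟩
    | fwd t k =>
      obtain ⟨n, hn⟩ := hS.2
      obtain ⟨Z₂, g₂, hg₂, hZ₂⟩ := hn.exists_allRev hN hS.1
      obtain ⟨n', hn'⟩ := hS'.2
      have r : N.Step S' (.rev t k) S :=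
        ⟨_, ((h.choose_spec.lstep hN hS.inv).1).undo hN hS.inv hS'.1⟩
      have c : N.CausEq g₁ (.cons _ r g₂) := causEq_of_allRev hN hn' hS'.1 hg₁ hg₂ hZ₁ hZ₂
      exact ⟨Z₂, g₂, hg₂, hZ₂, ((CausEq.cons h hc).trans (CausEq.cons h c)).trans
        (CausEq.comp_right (.cancelFwdRev h r) (SameTrace.refl g₂))⟩

/-- Executions to states that agree up to keys are causally equivalent. -/
theorem causEq_of_rekey (hN : N.WellFormed) {S : State P T A V} (hS : N.Valid S) {n : ℕ}
    {S₁ : State P T A V} (h₁ : N.LReach n S₁) : ∀ {φ : Equiv.Perm ℕ} (e₁ : N.Exec S S₁)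
      (e₂ : N.Exec S (S₁.rekey φ)), N.CausEq e₁ e₂ := by
  induction h₁ with
  | init h =>
    intro φ e₁ e₂
    obtain ⟨Z₁, g₁, hg₁, hZ₁, c₁⟩ := e₁.exists_allRev hN hS h.hist
    obtain ⟨Z₂, g₂, hg₂, hZ₂, c₂⟩ := e₂.exists_allRev hN hS fun t => by
      show φ '' _ = ∅
      rw [h.hist, Set.image_empty]
    obtain ⟨n, hn⟩ := hS.2
    exact (c₁.trans (causEq_of_allRev hN hn hS.1 hg₁ hg₂ hZ₁ hZ₂)).trans c₂.symm
  | @step n Q S₁ t k U hQ h ih =>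
    intro φ e₁ e₂
    have hS₁ := hS.exec hN e₁
    have hS₂ := hS.exec hN e₂
    have h' := h.rekey φ
    have r₁ : N.Step S₁ (.rev t k) Q := ⟨_, h.undo hN hQ.inv hS₁.1⟩
    have r₂ : N.Step (S₁.rekey φ) (.rev t (φ k)) (Q.rekey φ) :=
      ⟨_, h'.undo hN (hQ.inv.rekey φ) hS₂.1⟩
    obtain ⟨l₁, R₁, f₁, q₁⟩ := h.exists_redo hN hQ.inv
    obtain ⟨l₂, R₂, f₂, q₂⟩ := h'.exists_redo hN (hQ.inv.rekey φ)
    have s₁ : N.Step Q (.fwd t l₁) R₁ := ⟨_, f₁⟩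
    have s₂ : N.Step (Q.rekey φ) (.fwd t l₂) R₂ := ⟨_, f₂⟩
    have a : N.SameAction Q (.fwd t l₁) R₁ (Q.rekey φ) (.fwd t l₂) R₂ :=
      ⟨rfl, fun u o => by
        rw [(f₁.lstep hN hQ.inv).1.uses_iff hQ.inv,
          (f₂.lstep hN (hQ.inv.rekey φ)).1.uses_iff (hQ.inv.rekey φ), Tok.origin_rekey]⟩
    -- Both executions are prolonged by reversing the last occurrence, which makes the induction
    -- hypothesis applicable, and by redoing it. The two redone steps are the same action because
    -- renaming preserves origins.
    have c := CausEq.comp_right (ih (φ := φ) (e₁.comp (.cons _ r₁ (.nil Q)))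
      (e₂.comp (.cons _ r₂ (.nil _)))) (.cons s₁ s₂ a (.nil R₁ R₂))
    have assoc : ∀ {S S' S'' R : State P T A V} (e : N.Exec S S') (f : N.Exec S' S'')
        (g : N.Exec S'' R), (e.comp f).comp g = e.comp (f.comp g) := by
      intro S S' S'' R e f g
      induction e with
      | nil => rfl
      | cons α h e ih => exact congrArg _ (ih f)
    rw [assoc, assoc] at c
    have c₁ := CausEq.comp_left e₁ (.cancelRevFwd r₁ s₁ q₁)
    have c₂ := CausEq.comp_left e₂ (.cancelRevFwd r₂ s₂ q₂)
    rw [Exec.comp_nil] at c₁ c₂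
    exact (c₁.symm.trans c).trans c₂

end MRPN
end MultiRPN

theorem mainTheorem2 {P T A V : Type*} [Finite P] [Finite T] [Finite A] [Finite V]
    (N : MultiRPN.MRPN P T A V) (hN : N.WellFormed)
    (S S₁ S₂ : MultiRPN.State P T A V) (hS : N.Reachable S)
    (e₁ : N.Exec S S₁) (e₂ : N.Exec S S₂) :
    N.CausEq e₁ e₂ ↔ MultiRPN.MRPN.StateEquiv S₁ S₂ := by
  have hv := hS.valid hN
  have h₁ := hv.exec hN e₁
  rw [MultiRPN.MRPN.stateEquiv_iff h₁.1 (hv.exec hN e₂).1]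
  refine ⟨fun h => h.rekey hN hv, ?_⟩
  rintro ⟨φ, rfl⟩
  obtain ⟨n, hn⟩ := h₁.2
  exact MultiRPN.MRPN.causEq_of_rekey hN hv hn e₁ e₂
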